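/- In \emph{capacity-constrained facility location} (CCFL) there are $m$ facilities; facility $i$ has a fixed charge $c_i\ge 0$ and a capacity $u_i>0$, known in advance, as is the number $n$ of clients. Clients $1,\dots,n$ arrive one at a time; on arrival, client $j$ reveals for each facility $i$ a demand $p_{ij}\ge 0$ and an assignment cost $a_{ij}\ge 0$. The algorithm may then open further facilities and must irrevocably assign the client to an open facility. The \emph{total cost} of a solution is its maximum congestion $\max_i \frac{1}{u_i}\sum_{j\to i}p_{ij}$, plus the fixed charges of the opened facilities, plus the assignment costs of the clients. Write $w_{ij}=c_i+p_{ij}/u_i+a_{ij}$, assume that all $w_{ij}>0$, and let $\rho=\max_j\frac{\max_i w_{ij}}{\min_i w_{ij}}$. Let $Z^*$ be the least total cost of an assignment of all the clients. \emph{Unrelated machine scheduling with start-up costs} (UMSC) is the case $u_i=1$, $a_{ij}=0$: facilities are machines, clients are jobs, $p_{ij}$ are processing times, and the total cost is the makespan plus the start-up costs of the machines used. \textbf{Theorem.} There is a universal constant $C$ such that for all $m,n\ge 2$ and all $(c_i)$, $(u_i)$ there is a randomized online algorithm for CCFL, which knows neither $\rho$ nor $Z^*$, with the following properties on every sequence of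 $n$ clients (fixed independently of the algorithm's random choices). The algorithm works in successive epochs with a parameter $Z$ that equals $2^k\min_i w_{i1}$ in epoch $k=0,1,2,\dots$ (an epoch may be empty); the epoch of each client is determined by the clients that have arrived so far. In each epoch the algorithm starts anew, that is, facilities have to be opened and paid for again, and a client $j$ that arrives in an epoch with parameter $Z$ is assigned to a facility $i$ with $w_{ij}\le Z$. The parameter $Z$ never exceeds $2Z^*$ when a client is served. The sum over all epochs of the expected total cost in each epoch is at most $$C\,\ln^2(mn)\,\ln(mn\rho)\,Z^*,$$ and hence so is the expected total cost of the solution obtained for all the clients. The same holds, with the same bound, for UMSC. -/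

import Mathlib

open MeasureTheory

/-- What a client reveals on arrival: for each of the `m` facilities, the cost of assigning the
client there and the demand that the client then places on the facility. -/
structure Client (m : ℕ) where
  assignCost : Fin m → ℝ
  demand : Fin m → ℝ

/-- A randomized online algorithm, run in epochs, for `n` requests of type `R` and `m` facilities.
The number `n` of requests is known to it in advance. Its random choices are the point `ω` of a
probability space; the request sequence `σ` is fixed independently of `ω`.

When request `j` arrives, the algorithm first decides (deterministically, from the requests seen
so far) the index `epoch σ j` of the current epoch; it then opens the set `newOpen ω σ j` of
facilities and irrevocably assigns the request to the facility `target ω σ j`. Every epoch starts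
afresh, so that a request can only be assigned to a facility opened in the current epoch. -/
structure EpochAlgorithm (R : Type) (m n : ℕ) where
  Ω : Type
  [measurableSpace : MeasurableSpace Ω]
  μ : Measure Ω
  [isProbabilityMeasure : IsProbabilityMeasure μ]
  epoch : (Fin n → R) → Fin n → ℕ
  newOpen : Ω → (Fin n → R) → Fin n → Finset (Fin m)
  target : Ω → (Fin n → R) → Fin n → Fin m
  /-- Decisions at request `j` depend on the requests up to `j` only. -/
  epoch_online : ∀ (σ τ : Fin n → R) (j : Fin n), (∀ k ≤ j, σ k = τ k) → epoch σ j = epoch τ j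
  newOpen_online : ∀ (ω : Ω) (σ τ : Fin n → R) (j : Fin n), (∀ k ≤ j, σ k = τ k) →
    newOpen ω σ j = newOpen ω τ j
  target_online : ∀ (ω : Ω) (σ τ : Fin n → R) (j : Fin n), (∀ k ≤ j, σ k = τ k) →
    target ω σ j = target ω τ j
  epoch_monotone : ∀ σ : Fin n → R, Monotone (epoch σ)
  target_open : ∀ (ω : Ω) (σ : Fin n → R) (j : Fin n),
    ∃ k ≤ j, epoch σ k = epoch σ j ∧ target ω σ j ∈ newOpen ω σ k
  measurableSet_newOpen : ∀ (σ : Fin n → R) (j : Fin n) (s : Finset (Fin m)),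
    MeasurableSet {ω | newOpen ω σ j = s}
  measurableSet_target : ∀ (σ : Fin n → R) (j : Fin n) (i : Fin m),
    MeasurableSet {ω | target ω σ j = i}

attribute [instance] EpochAlgorithm.measurableSpace EpochAlgorithm.isProbabilityMeasure

namespace EpochAlgorithm

variable {R : Type} {m n : ℕ} (A : EpochAlgorithm R m n)

/-- The epochs in which some request is served. -/
def epochs (σ : Fin n → R) : Finset ℕ :=
  Finset.univ.image (A.epoch σ)

/-- The requests served in epoch `k`. -/
def served (σ : Fin n → R) (k : ℕ) : Finset (Fin n) :=
  Finset.univ.filter fun j => A.epoch σ j = k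

/-- The facilities opened in epoch `k`. -/
def openedIn (ω : A.Ω) (σ : Fin n → R) (k : ℕ) : Finset (Fin m) :=
  (A.served σ k).biUnion (A.newOpen ω σ)

/-- The facilities opened in the whole run. -/
def opened (ω : A.Ω) (σ : Fin n → R) : Finset (Fin m) :=
  Finset.univ.biUnion (A.newOpen ω σ)

end EpochAlgorithm

/-- `ρ`, where `w j i` is the total cost of assigning request `j` alone to facility `i`. -/
noncomputable def costRatio {m n : ℕ} (w : Fin n → Fin m → ℝ) : ℝ :=
  ⨆ j, (⨆ i, w j i) / (⨅ i, w j i)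

/-- The value of `Z` in force when request `j` arrives: `Z` starts at the cheapest way to serve the
first request alone and is doubled from each epoch to the next. -/
noncomputable def EpochAlgorithm.currentZ {R : Type} {m n : ℕ} (A : EpochAlgorithm R m n)
    (w : Fin n → Fin m → ℝ) (σ : Fin n → R) (j : Fin n) : ℝ :=
  2 ^ A.epoch σ j * ⨅ i, w ⟨0, j.pos⟩ i

section CCFL

variable {m n : ℕ} (c u : Fin m → ℝ) (σ : Fin n → Client m)

/-- The total cost of client `j` if it is assigned alone to facility `i`. -/
noncomputable def ccflSingle (j : Fin n) (i : Fin m) : ℝ :=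
  c i + (σ j).demand i / u i + (σ j).assignCost i

/-- Total cost of serving the clients in `J` by the assignment `f` with open facilities `O`:
maximum congestion, fixed charges and assignment costs. -/
noncomputable def ccflCost (J : Finset (Fin n)) (O : Finset (Fin m)) (f : Fin n → Fin m) : ℝ :=
  (⨆ i, (∑ j ∈ J with f j = i, (σ j).demand i) / u i)
    + ∑ i ∈ O, c i + ∑ j ∈ J, (σ j).assignCost (f j)

/-- `Z*`, the least total cost of an assignment of all the clients. -/
noncomputable def ccflOpt : ℝ :=
  ⨅ f : Fin n → Fin m, ccflCost c u σ Finset.univ (Finset.univ.image f) f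

/-- Sum over the epochs of the expected total cost in each epoch. -/
noncomputable def ccflEpochCost (A : EpochAlgorithm (Client m) m n) : ℝ :=
  ∑ k ∈ A.epochs σ,
    ∫ ω, ccflCost c u σ (A.served σ k) (A.openedIn ω σ k) (A.target ω σ) ∂A.μ

/-- Expected total cost of the solution produced for all the clients together. -/
noncomputable def ccflTotalCost (A : EpochAlgorithm (Client m) m n) : ℝ :=
  ∫ ω, ccflCost c u σ Finset.univ (A.opened ω σ) (A.target ω σ) ∂A.μ

end CCFL

section UMSC

variable {m n : ℕ} (c : Fin m → ℝ) (p : Fin n → Fin m → ℝ)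

/-- The total cost of job `j` if it is scheduled alone on machine `i`. -/
def umscSingle (j : Fin n) (i : Fin m) : ℝ :=
  c i + p j i

/-- Makespan plus start-up costs, for the jobs in `J`, the started machines `O` and the
schedule `f`. -/
noncomputable def umscCost (J : Finset (Fin n)) (O : Finset (Fin m)) (f : Fin n → Fin m) : ℝ :=
  (⨆ i, ∑ j ∈ J with f j = i, p j i) + ∑ i ∈ O, c i

/-- The least total cost of a schedule of all the jobs. -/
noncomputable def umscOpt : ℝ :=
  ⨅ f : Fin n → Fin m, umscCost c p Finset.univ (Finset.univ.image f) f

/-- Sum over the epochs of the expected total cost in each epoch. -/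
noncomputable def umscEpochCost (A : EpochAlgorithm (Fin m → ℝ) m n) : ℝ :=
  ∑ k ∈ A.epochs p,
    ∫ ω, umscCost c p (A.served p k) (A.openedIn ω p k) (A.target ω p) ∂A.μ

/-- Expected total cost of the schedule produced for all the jobs together. -/
noncomputable def umscTotalCost (A : EpochAlgorithm (Fin m → ℝ) m n) : ℝ :=
  ∫ ω, umscCost c p Finset.univ (A.opened ω p) (A.target ω p) ∂A.μ

end UMSC

/-! Scale an epoch so that `Z = 1`; its clients then have an assignment of cost at most one. Every
facility carries a weight `y i`, initially `1 / m` and possibly growing beyond one; truncated at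
one, it measures how far the facility is open. For an arriving client a price level `τ` rises from
zero. Facility `i` becomes available at its own price `q i = a i + c i * p i * max 1 (y i) / 10`,
after which its weight grows exponentially in `τ` at rate `1 / c i`; the level stops once the
available truncated weights can sum to one. A subset of truncated weight between one and two is
offered to the client, and the offered weights are finally multiplied by `exp (p i / 10)`. All this
costs `O(τ)` in charges and assignment (`exists_isStep`).

The levels `τ` act as dual prices. Summed along the cheap assignment, their logarithmic parts
telescope to `O(log m)`, and their load parts are at most a constant plus half of the total price,
so the total price is `O(log m)` (`IsRun.sum_price_le`). Weights therefore stay below `m * O(log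
m)`. As each offer multiplies a weight by `exp (p i / 10)`, the total demand of the clients offered
to a facility is also `O(log m)` (`IsRun.sum_offered_le`). This bounds congestion for every outcome
of the rounding, without concentration inequalities.

For the rounding, each facility draws one uniform threshold and is ready when `L = log (m n)` times
its weight reaches it. A client finds no ready facility among those offered with probability at most
`exp (-L) ≤ 1 / n`, and then costs `O(Z)`; otherwise expected charges and assignment costs are `L`
times the fractional ones. An epoch thus costs `O(L ^ 2) Z` (`ValidInput.exists_epoch_bound`). The
values of `Z` double and end below `2 Z*`, so they sum to at most `4 Z*`. The factor `log (m n ρ)`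
is at least one and is not needed. -/

/-! ### The fractional step for one client -/

/-- One step of the fractional algorithm, with normalized fixed charges `c`. A client with assignment
costs `a` and demands `p`, which may use the facilities in `F`, turns the weights `y` into `y'` and is
offered the facilities in `E`; the price that it pays is `τ`. -/
structure IsStep {ι : Type*} [Fintype ι] (c a p : ι → ℝ) (F : Finset ι) (y y' : ι → ℝ)
    (E : Finset ι) (τ : ℝ) : Prop where
  price_nonneg : 0 ≤ τ
  le_next : ∀ i, y i ≤ y' i
  subset : E ⊆ F
  growth : ∀ i ∈ E, y i * Real.exp (p i / 10) ≤ y' i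
  cover : 1 ≤ ∑ i ∈ E, min 1 (y' i)
  charge : ∑ i, c i * y' i ≤ ∑ i, c i * y i + 5 * τ
  assign : ∑ i ∈ E, a i * min 1 (y' i) ≤ 4 * τ
  price_le : ∀ i ∈ F, τ ≤ a i + c i * p i * max 1 (y i) / 10
    + c i * (Real.log (min 1 (y' i)) - Real.log (min 1 (y i)))

/-- The weight `y` of a facility with charge `c` and price `q`, raised up to the price level `τ`. -/
noncomputable def raisedWeight (c q y τ : ℝ) : ℝ :=
  y * Real.exp (max 0 (τ - q) / c)

lemma continuous_raisedWeight (c q y : ℝ) : Continuous (raisedWeight c q y) := by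
  unfold raisedWeight
  fun_prop

lemma le_raisedWeight {c q y τ : ℝ} (hc : 0 < c) (hy : 0 < y) : y ≤ raisedWeight c q y τ := by
  unfold raisedWeight
  have : 1 ≤ Real.exp (max 0 (τ - q) / c) := Real.one_le_exp (by positivity)
  nlinarith

lemma raisedWeight_of_le {c q y τ : ℝ} (h : τ ≤ q) : raisedWeight c q y τ = y := by
  unfold raisedWeight
  rw [max_eq_left (by linarith)]
  simp

/-- With `x = (τ - q) / c`, the old weight is `exp (-x)` times the raised one, and `1 - exp (-x) ≤
x`. -/
lemma charge_raisedWeight_sub_le {c q y τ : ℝ} (hc : 0 < c) (hy : 0 < y) (hq : 0 ≤ q)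
    (h : q ≤ τ) : c * (raisedWeight c q y τ - y) ≤ τ * raisedWeight c q y τ := by
  set r := raisedWeight c q y τ with hr
  have hy' : y = r * Real.exp (-((τ - q) / c)) := by
    rw [hr, raisedWeight, max_eq_right (by linarith), mul_assoc, ← Real.exp_add]
    simp
  have hr0 : 0 < r := hy.trans_le (le_raisedWeight hc hy)
  have h1 : 1 - (τ - q) / c ≤ Real.exp (-((τ - q) / c)) := by
    have := Real.add_one_le_exp (-((τ - q) / c))
    linarith
  have h2 : r - y ≤ r * ((τ - q) / c) := by
    rw [hy']
    nlinarith
  calc c * (r - y) ≤ c * (r * ((τ - q) / c)) := by gcongr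
    _ = r * (τ - q) := by field_simp
    _ ≤ τ * r := by nlinarith

/-- A subset of minimal size among those of total weight at least one has weight at most two. -/
lemma exists_subset_sum_le_two {ι : Type*} [DecidableEq ι] (A : Finset ι) (x : ι → ℝ)
    (hx : ∀ i, x i ≤ 1) (hA : 1 ≤ ∑ i ∈ A, x i) :
    ∃ E ⊆ A, 1 ≤ ∑ i ∈ E, x i ∧ ∑ i ∈ E, x i ≤ 2 := by
  induction A using Finset.induction_on with
  | empty => simp at hA; linarith
  | insert b s hb ih =>
    by_cases h : 1 ≤ ∑ i ∈ s, x i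
    · obtain ⟨E, hE, h1, h2⟩ := ih h
      exact ⟨E, hE.trans (Finset.subset_insert b s), h1, h2⟩
    · refine ⟨insert b s, subset_rfl, hA, ?_⟩
      rw [Finset.sum_insert hb]
      linarith [hx b]

/-- The least price level at which the facilities that have become available suffice. -/
lemma exists_least_level {ι : Type*} [DecidableEq ι] (F : Finset ι) (hF : F.Nonempty)
    (c q y : ι → ℝ) (hc : ∀ i, 0 < c i) (hy : ∀ i, 0 < y i) (hq : ∀ i ∈ F, 0 ≤ q i) :
    ∃ τ, 0 ≤ τ ∧ (∃ A ⊆ F, (∀ i ∈ A, q i ≤ τ) ∧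
        1 ≤ ∑ i ∈ A, min 1 (raisedWeight (c i) (q i) (y i) τ)) ∧
      ∑ i ∈ F with q i < τ, raisedWeight (c i) (q i) (y i) τ ≤ 1 := by
  -- A finite union of closed sets of levels. Availability jumps at the prices `q i`, but each fixed
  -- `A` gives a closed condition, so the least level is attained.
  set S : Set ℝ := ⋃ A ∈ F.powerset, {τ | (∀ i ∈ A, q i ≤ τ) ∧
        1 ≤ ∑ i ∈ A, min 1 (raisedWeight (c i) (q i) (y i) τ)} with hS
  have hmem : ∀ τ, τ ∈ S ↔ ∃ A ⊆ F, (∀ i ∈ A, q i ≤ τ) ∧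
        1 ≤ ∑ i ∈ A, min 1 (raisedWeight (c i) (q i) (y i) τ) := by
    intro τ
    simp only [hS, Set.mem_iUnion, Finset.mem_powerset, Set.mem_ofPred_eq, exists_prop]
  have hclosed : IsClosed S := by
    refine Set.Finite.isClosed_biUnion (Finset.finite_toSet _) fun A _ => ?_
    have h1 : IsClosed {τ : ℝ | ∀ i ∈ A, q i ≤ τ} := by
      simp only [Set.ofPred_forall]
      exact isClosed_biInter fun i _ => isClosed_Ici
    have h2 : Continuous fun τ => ∑ i ∈ A, min 1 (raisedWeight (c i) (q i) (y i) τ) :=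
      continuous_finsetSum _ fun i _ => continuous_const.min (continuous_raisedWeight _ _ _)
    exact h1.inter (isClosed_le continuous_const h2)
  have hbdd : ∀ τ ∈ S, 0 ≤ τ := by
    intro τ hτ
    obtain ⟨A, hA, h1, h2⟩ := (hmem τ).1 hτ
    rcases A.eq_empty_or_nonempty with rfl | ⟨i, hi⟩
    · simp at h2; linarith
    · exact (hq i (hA hi)).trans (h1 i hi)
  have hne : S.Nonempty := by
    obtain ⟨i, hi⟩ := hF
    -- A single facility suffices at this level, because `y * exp (1 / y) ≥ y * (1 / y) = 1`.
    refine ⟨q i + c i * (y i)⁻¹, (hmem _).2 ⟨{i}, by simpa using hi, ?_, ?_⟩⟩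
    · intro k hk
      rw [Finset.mem_singleton] at hk
      subst hk
      have := mul_pos (hc k) (inv_pos.2 (hy k))
      linarith
    · rw [Finset.sum_singleton, le_min_iff]
      refine ⟨le_rfl, ?_⟩
      have hpos : 0 < c i * (y i)⁻¹ := mul_pos (hc i) (inv_pos.2 (hy i))
      rw [raisedWeight, add_sub_cancel_left, max_eq_right hpos.le,
        mul_div_cancel_left₀ _ (hc i).ne']
      have h1 := Real.add_one_le_exp (y i)⁻¹
      calc (1 : ℝ) = y i * (y i)⁻¹ := (mul_inv_cancel₀ (hy i).ne').symm
        _ ≤ _ := by gcongr; exacts [(hy i).le, by linarith]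
  have hin : sInf S ∈ S := hclosed.csInf_mem hne ⟨0, hbdd⟩
  refine ⟨sInf S, hbdd _ hin, (hmem _).1 hin, ?_⟩
  set τ := sInf S
  -- The facilities with price strictly below `τ` are available just below `τ` and do not suffice
  -- there; the bound passes to the limit from the left.
  have hlim : Filter.Tendsto
      (fun s => ∑ i ∈ F with q i < τ, raisedWeight (c i) (q i) (y i) s)
      (nhdsWithin τ (Set.Iio τ))
      (nhds (∑ i ∈ F with q i < τ, raisedWeight (c i) (q i) (y i) τ)) := by
    refine ((continuous_finsetSum _ fun i _ =>
      continuous_raisedWeight _ _ _).tendsto τ).mono_left nhdsWithin_le_nhds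
  refine le_of_tendsto hlim ?_
  have hev : ∀ᶠ s in nhdsWithin τ (Set.Iio τ), ∀ i ∈ F.filter (fun i => q i < τ), q i ≤ s := by
    rw [Filter.eventually_all_finset]
    intro i hi
    have : q i < τ := (Finset.mem_filter.1 hi).2
    exact nhdsWithin_le_nhds ((eventually_gt_nhds this).mono fun _ h => le_of_lt h)
  filter_upwards [hev, self_mem_nhdsWithin] with s hs hlt
  have hnot : ¬ 1 ≤ ∑ i ∈ F with q i < τ, min 1 (raisedWeight (c i) (q i) (y i) s) := by
    intro h
    have : s ∈ S := (hmem s).2 ⟨_, Finset.filter_subset _ _, hs, h⟩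
    exact absurd (csInf_le ⟨0, hbdd⟩ this) (not_le.2 hlt)
  push Not at hnot
  have hpos : ∀ i, 0 < raisedWeight (c i) (q i) (y i) s := fun i =>
    (hy i).trans_le (le_raisedWeight (hc i) (hy i))
  -- A truncated sum below one means that no term is truncated.
  refine (Finset.sum_le_sum fun i hi => ?_).trans hnot.le
  have h1 : min 1 (raisedWeight (c i) (q i) (y i) s) < 1 :=
    (Finset.single_le_sum (f := fun i => min 1 (raisedWeight (c i) (q i) (y i) s))
      (fun k _ => le_min zero_le_one (hpos k).le) hi).trans_lt hnot
  rcases min_lt_iff.1 h1 with h | h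
  · exact absurd h (lt_irrefl _)
  · rw [min_eq_right h.le]

lemma exp_sub_one_le_two_mul {x : ℝ} (h0 : 0 ≤ x) (h1 : x ≤ 1) : Real.exp x - 1 ≤ 2 * x := by
  have this := Real.abs_exp_sub_one_le (x := x) (by rw [abs_of_nonneg h0]; exact h1)
  rw [abs_of_nonneg h0] at this
  exact (le_abs_self _).trans this

lemma min_one_mul_le {x k : ℝ} (hk : 1 ≤ k) : min 1 (x * k) ≤ k * min 1 x := by
  rcases le_total 1 x with h | h
  · rw [min_eq_left h]; exact (min_le_left _ _).trans (by linarith)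
  · rw [min_eq_right h]; exact (min_le_right _ _).trans (by linarith)

/-- Raising the weights to the level `τ` costs at most `τ` in charges, since the raised weights sum
to at most one. The multiplication by `exp (p i / 10)` costs at most `2 * min 1 (h i) * q i` per
offered facility, hence `4 * τ` in all: this is what the load term of `q` pays for. -/
theorem exists_isStep {ι : Type*} [Fintype ι] (c a p y : ι → ℝ) (F : Finset ι) (hF : F.Nonempty)
    (hc : ∀ i, 0 < c i) (hy : ∀ i, 0 < y i) (ha : ∀ i ∈ F, 0 ≤ a i) (hp : ∀ i ∈ F, 0 ≤ p i)
    (hp1 : ∀ i ∈ F, p i ≤ 1) : ∃ y' E τ, IsStep c a p F y y' E τ := by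
  classical
  set q : ι → ℝ := fun i => a i + c i * p i * max 1 (y i) / 10 with hq
  have hload0 : ∀ i ∈ F, 0 ≤ c i * p i * max 1 (y i) / 10 := fun i hi => by
    have h1 := (hc i).le
    have h2 := hp i hi
    have h3 : 0 ≤ max 1 (y i) := zero_le_one.trans (le_max_left _ _)
    positivity
  have hq0 : ∀ i ∈ F, 0 ≤ q i := fun i hi => add_nonneg (ha i hi) (hload0 i hi)
  obtain ⟨τ, hτ, ⟨A, hAF, hAq, hA1⟩, hB⟩ := exists_least_level F hF c q y hc hy hq0
  set h : ι → ℝ := fun i => if i ∈ F then raisedWeight (c i) (q i) (y i) τ else y i with hh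
  have hle : ∀ i, y i ≤ h i := fun i => by
    simp only [hh]; split_ifs
    exacts [le_raisedWeight (hc i) (hy i), le_rfl]
  have hh0 : ∀ i, 0 < h i := fun i => (hy i).trans_le (hle i)
  have hsame : ∀ i, ¬ (i ∈ F ∧ q i < τ) → h i = y i := fun i hi => by
    simp only [hh]; split_ifs with hiF
    · exact raisedWeight_of_le (not_lt.1 fun h => hi ⟨hiF, h⟩)
    · rfl
  have hB' : ∑ i ∈ F with q i < τ, h i ≤ 1 := by
    refine le_of_eq_of_le (Finset.sum_congr rfl fun i hi => ?_) hB
    simp [hh, (Finset.mem_filter.1 hi).1]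
  have hone : ∀ i, i ∈ F ∧ q i < τ → h i ≤ 1 := fun i hi =>
    (Finset.single_le_sum (f := h) (fun k _ => (hh0 k).le) (Finset.mem_filter.2 hi)).trans hB'
  -- A facility is raised only while its weight stays at most one, so the load term of its price may
  -- be read with the old or the new weight.
  have hmax : ∀ i, max 1 (h i) = max 1 (y i) := fun i => by
    by_cases hi : i ∈ F ∧ q i < τ
    · rw [max_eq_left (hone i hi), max_eq_left ((hle i).trans (hone i hi))]
    · rw [hsame i hi]
  obtain ⟨E, hEA, hE1, hE2⟩ := exists_subset_sum_le_two A (fun i => min 1 (h i))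
    (fun i => min_le_left _ _)
    (hA1.trans_eq (Finset.sum_congr rfl fun i hi => by simp [hh, hAF hi]))
  have hEF := hEA.trans hAF
  have hexp1 : ∀ i ∈ F, 1 ≤ Real.exp (p i / 10) := fun i hi =>
    Real.one_le_exp (by linarith [hp i hi])
  have hexp2 : ∀ i ∈ F, Real.exp (p i / 10) - 1 ≤ 2 * (p i / 10) := fun i hi =>
    exp_sub_one_le_two_mul (by linarith [hp i hi]) (by linarith [hp1 i hi])
  set y' : ι → ℝ := fun i => if i ∈ E then h i * Real.exp (p i / 10) else h i with hy'
  have hle' : ∀ i, h i ≤ y' i := fun i => by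
    simp only [hy']; split_ifs with hi
    · exact le_mul_of_one_le_right (hh0 i).le (hexp1 i (hEF hi))
    · exact le_rfl
  have hmin0 : ∀ i, 0 ≤ min 1 (h i) := fun i => le_min zero_le_one (hh0 i).le
  have hpay : ∑ i ∈ E, min 1 (h i) * q i ≤ 2 * τ := by
    calc ∑ i ∈ E, min 1 (h i) * q i ≤ ∑ i ∈ E, min 1 (h i) * τ :=
          Finset.sum_le_sum fun i hi => mul_le_mul_of_nonneg_left (hAq i (hEA hi)) (hmin0 i)
      _ = (∑ i ∈ E, min 1 (h i)) * τ := (Finset.sum_mul _ _ _).symm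
      _ ≤ 2 * τ := by gcongr
  refine ⟨y', E, τ, hτ, fun i => (hle i).trans (hle' i), hEF, ?_, ?_, ?_, ?_, ?_⟩
  · intro i hi
    simp only [hy', if_pos hi]
    have := hle i
    gcongr
  · exact hE1.trans (Finset.sum_le_sum fun i _ => min_le_min_left _ (hle' i))
  · have h1 : ∑ i, c i * (h i - y i) ≤ τ := by
      calc ∑ i, c i * (h i - y i) = ∑ i ∈ F with q i < τ, c i * (h i - y i) := by
            symm
            refine Finset.sum_subset (Finset.subset_univ _) fun i _ hi => ?_
            rw [hsame i (by simpa using hi)]; simp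
        _ ≤ ∑ i ∈ F with q i < τ, τ * h i := by
            refine Finset.sum_le_sum fun i hi => ?_
            obtain ⟨hiF, hiq⟩ := Finset.mem_filter.1 hi
            simp only [hh, if_pos hiF]
            exact charge_raisedWeight_sub_le (hc i) (hy i) (hq0 i hiF) hiq.le
        _ = τ * ∑ i ∈ F with q i < τ, h i := (Finset.mul_sum _ _ _).symm
        _ ≤ τ * 1 := by gcongr
        _ = τ := mul_one τ
    have h2 : ∑ i, c i * (y' i - h i) ≤ 4 * τ := by
      calc ∑ i, c i * (y' i - h i) = ∑ i ∈ E, c i * (y' i - h i) := by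
            symm
            refine Finset.sum_subset (Finset.subset_univ _) fun i _ hi => ?_
            simp [hy', if_neg hi]
        _ ≤ ∑ i ∈ E, 2 * (min 1 (h i) * q i) := by
            refine Finset.sum_le_sum fun i hi => ?_
            simp only [hy', if_pos hi]
            have e1 : c i * (h i * Real.exp (p i / 10) - h i) ≤ c i * h i * (2 * (p i / 10)) := by
              have := mul_le_mul_of_nonneg_left (hexp2 i (hEF hi))
                (mul_pos (hc i) (hh0 i)).le
              linarith
            have e2 : h i = min 1 (h i) * max 1 (y i) := by
              rw [← hmax i, min_mul_max, one_mul]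
            have e3 : c i * h i * (2 * (p i / 10))
                = 2 * (min 1 (h i) * (c i * p i * max 1 (y i) / 10)) := by
              conv_lhs => rw [e2]
              ring
            have e4 : min 1 (h i) * (c i * p i * max 1 (y i) / 10) ≤ min 1 (h i) * q i :=
              mul_le_mul_of_nonneg_left (le_add_of_nonneg_left (ha i (hEF hi))) (hmin0 i)
            linarith
        _ = 2 * ∑ i ∈ E, min 1 (h i) * q i := (Finset.mul_sum _ _ _).symm
        _ ≤ 4 * τ := by linarith
    have h3 : ∑ i, c i * y' i = ∑ i, c i * y i + ∑ i, c i * (h i - y i)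
        + ∑ i, c i * (y' i - h i) := by
      rw [← Finset.sum_add_distrib, ← Finset.sum_add_distrib]
      exact Finset.sum_congr rfl fun i _ => by ring
    linarith
  · calc ∑ i ∈ E, a i * min 1 (y' i) ≤ ∑ i ∈ E, 2 * (min 1 (h i) * q i) := by
          refine Finset.sum_le_sum fun i hi => ?_
          have e1 : min 1 (y' i) ≤ 2 * min 1 (h i) := by
            simp only [hy', if_pos hi]
            refine (min_one_mul_le (hexp1 i (hEF hi))).trans ?_
            have := hexp2 i (hEF hi)
            have := hp1 i (hEF hi)
            exact mul_le_mul_of_nonneg_right (by linarith) (hmin0 i)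
          have e2 := mul_le_mul_of_nonneg_left e1 (ha i (hEF hi))
          have e3 : min 1 (h i) * a i ≤ min 1 (h i) * q i :=
            mul_le_mul_of_nonneg_left (le_add_of_nonneg_right (hload0 i (hEF hi))) (hmin0 i)
          linarith
      _ = 2 * ∑ i ∈ E, min 1 (h i) * q i := (Finset.mul_sum _ _ _).symm
      _ ≤ 4 * τ := by linarith
  · intro i hi
    have hmono : ∀ {x z : ℝ}, 0 < x → x ≤ z → Real.log (min 1 x) ≤ Real.log (min 1 z) :=
      fun hx hxz => Real.log_le_log (lt_min one_pos hx) (min_le_min_left _ hxz)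
    -- Below its price a facility owes nothing beyond `q i`; above it, `c i` times the growth of the
    -- logarithm is at least `τ - q i`.
    rcases le_or_gt τ (q i) with hiq | hiq
    · have := mul_nonneg (hc i).le
        (sub_nonneg.2 (hmono (hy i) ((hle i).trans (hle' i))))
      exact hiq.trans (le_add_of_nonneg_right this)
    · have e1 := hone i ⟨hi, hiq⟩
      have e2 := hmono (hh0 i) (hle' i)
      have e3 : Real.log (min 1 (h i)) = Real.log (min 1 (y i)) + (τ - q i) / c i := by
        rw [min_eq_right e1, min_eq_right ((hle i).trans e1)]
        simp only [hh, if_pos hi]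
        rw [raisedWeight, Real.log_mul (hy i).ne' (Real.exp_pos _).ne', Real.log_exp,
          max_eq_right (by linarith)]
      have e4 : c i * ((τ - q i) / c i) = τ - q i := mul_div_cancel₀ _ (hc i).ne'
      have e5 : (τ - q i) / c i ≤ Real.log (min 1 (y' i)) - Real.log (min 1 (y i)) := by linarith
      have e6 := mul_le_mul_of_nonneg_left e5 (hc i).le
      simp only [hq] at e4 e6 ⊢
      linarith

/-! ### Logarithmic bounds for the fractional algorithm in one epoch -/

section Run

variable {m n : ℕ}

/-- The normalized data of one epoch: the clients in `J` are processed one after another, starting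
from the weights `1 / m`, and `f` is a solution of cost at most one for them. -/
structure IsRun (c : Fin m → ℝ) (a p : Fin n → Fin m → ℝ) (J : Finset (Fin n))
    (F E : Fin n → Finset (Fin m)) (Y : ℕ → Fin m → ℝ) (τ : Fin n → ℝ) (f : Fin n → Fin m) :
    Prop where
  charge_ge : ∀ i, 1 / (m : ℝ) ≤ c i
  charge_le : ∀ i, c i ≤ 1
  demand_nonneg : ∀ j i, 0 ≤ p j i
  start : ∀ i, Y 0 i = 1 / m
  step : ∀ j ∈ J, IsStep c (a j) (p j) (F j) (Y j) (Y (j + 1)) (E j) (τ j)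
  stay : ∀ j : Fin n, j ∉ J → Y (j + 1) = Y j
  mem : ∀ j ∈ J, f j ∈ F j
  load_le : ∀ i, ∑ j ∈ J with f j = i, p j i ≤ 1
  assign_le : ∑ j ∈ J, a j (f j) ≤ 1
  open_le : ∑ i ∈ J.image f, c i ≤ 2

/-- Increments that vanish outside `J` telescope. -/
lemma sum_sub_eq_of_stay (J : Finset (Fin n)) {X : Type*} (Y : ℕ → X)
    (hstay : ∀ j : Fin n, j ∉ J → Y (j + 1) = Y j) (g : X → ℝ) :
    ∑ j ∈ J, (g (Y (j + 1)) - g (Y j)) = g (Y n) - g (Y 0) := by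
  rw [← Finset.sum_range_sub (fun t => g (Y t)) n,
    ← Fin.sum_univ_eq_sum_range (fun t => g (Y (t + 1)) - g (Y t)) n]
  refine Finset.sum_subset (Finset.subset_univ _) fun j _ hj => ?_
  rw [hstay j hj, sub_self]

namespace IsRun

variable {c : Fin m → ℝ} {a p : Fin n → Fin m → ℝ} {J : Finset (Fin n)}
  {F E : Fin n → Finset (Fin m)} {Y : ℕ → Fin m → ℝ} {τ : Fin n → ℝ} {f : Fin n → Fin m}

lemma le_succ (H : IsRun c a p J F E Y τ f) (j : Fin n) (i : Fin m) : Y j i ≤ Y (j + 1) i := by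
  by_cases hj : j ∈ J
  · exact (H.step j hj).le_next i
  · rw [H.stay j hj]

lemma mono (H : IsRun c a p J F E Y τ f) {s t : ℕ} (hst : s ≤ t) (ht : t ≤ n) (i : Fin m) : Y s i ≤ Y t i := by
  induction t, hst using Nat.le_induction with
  | base => exact le_rfl
  | succ t _ ih => exact (ih (by omega)).trans (H.le_succ ⟨t, by omega⟩ i)

lemma charge_pos (H : IsRun c a p J F E Y τ f) (hm : 0 < m) (i : Fin m) : 0 < c i :=
  lt_of_lt_of_le (by positivity) (H.charge_ge i)

lemma weight_pos (H : IsRun c a p J F E Y τ f) (hm : 0 < m) {t : ℕ} (ht : t ≤ n) (i : Fin m) :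
    0 < Y t i :=
  lt_of_lt_of_le (by rw [H.start]; positivity) (H.mono (Nat.zero_le t) ht i)

lemma sum_charge_le (H : IsRun c a p J F E Y τ f) :
    ∑ i, c i * Y n i ≤ 1 + 5 * ∑ j ∈ J, τ j := by
  have h1 : ∑ j ∈ J, (∑ i, c i * Y (j + 1) i - ∑ i, c i * Y j i) ≤ ∑ j ∈ J, 5 * τ j :=
    Finset.sum_le_sum fun j hj => by linarith [(H.step j hj).charge]
  rw [sum_sub_eq_of_stay J Y H.stay fun y => ∑ i, c i * y i, ← Finset.mul_sum] at h1
  have h2 : ∑ i, c i * Y 0 i ≤ 1 := by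
    calc ∑ i, c i * Y 0 i ≤ ∑ _i : Fin m, 1 / (m : ℝ) := Finset.sum_le_sum fun i _ => by
          rw [H.start]
          exact mul_le_of_le_one_left (by positivity) (H.charge_le i)
      _ ≤ 1 := by
          rw [Finset.sum_const, Finset.card_univ, Fintype.card_fin, nsmul_eq_mul]
          rcases Nat.eq_zero_or_pos m with rfl | hm
          · simp
          · exact (mul_one_div_cancel (by positivity)).le
  linarith

/-- Weights only grow, so `max 1 (Y j i)` is at most `1 + Y n i`, and the comparison solution puts
load at most one on each facility. -/
lemma sum_load_price_le (H : IsRun c a p J F E Y τ f) (hm : 0 < m) :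
    ∑ j ∈ J, c (f j) * p j (f j) * max 1 (Y j (f j)) / 10
      ≤ (2 + ∑ i, c i * Y n i) / 10 := by
  have hc := H.charge_pos hm
  have hY := fun i => H.weight_pos hm (le_refl n) i
  calc ∑ j ∈ J, c (f j) * p j (f j) * max 1 (Y j (f j)) / 10
      ≤ ∑ j ∈ J, c (f j) * (1 + Y n (f j)) / 10 * p j (f j) := by
        refine Finset.sum_le_sum fun j _ => ?_
        have h1 : max 1 (Y j (f j)) ≤ 1 + Y n (f j) :=
          max_le (by linarith [hY (f j)]) (by linarith [H.mono j.2.le le_rfl (f j)])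
        have := mul_le_mul_of_nonneg_left h1
          (mul_nonneg (hc (f j)).le (H.demand_nonneg j (f j)))
        linarith
    _ = ∑ i ∈ J.image f, ∑ j ∈ J with f j = i, c i * (1 + Y n i) / 10 * p j i := by
        rw [← Finset.sum_fiberwise_of_maps_to (fun j hj => Finset.mem_image_of_mem f hj)]
        refine Finset.sum_congr rfl fun i _ => Finset.sum_congr rfl fun j hj => ?_
        rw [(Finset.mem_filter.1 hj).2]
    _ ≤ ∑ i ∈ J.image f, (c i + c i * Y n i) / 10 := by
        refine Finset.sum_le_sum fun i _ => ?_
        rw [← Finset.mul_sum]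
        have := mul_le_mul_of_nonneg_left (H.load_le i)
          (mul_nonneg (hc i).le (by linarith [hY i] : 0 ≤ 1 + Y n i))
        linarith
    _ = (∑ i ∈ J.image f, c i + ∑ i ∈ J.image f, c i * Y n i) / 10 := by
        rw [← Finset.sum_div, Finset.sum_add_distrib]
    _ ≤ (2 + ∑ i, c i * Y n i) / 10 := by
        have := Finset.sum_le_sum_of_subset_of_nonneg (Finset.subset_univ (J.image f))
          (f := fun i => c i * Y n i) fun i _ _ => (mul_pos (hc i) (hY i)).le
        have := H.open_le
        gcongr

/-- The truncated logarithm of a weight rises from `-log m` to at most zero. Increments at clients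
assigned elsewhere are nonnegative and may be added, which makes the sum telescope. -/
lemma sum_log_increase_le (H : IsRun c a p J F E Y τ f) (hm : 0 < m) :
    ∑ j ∈ J, c (f j) * (Real.log (min 1 (Y (j + 1) (f j))) - Real.log (min 1 (Y j (f j))))
      ≤ 2 * Real.log m := by
  have hc := H.charge_pos hm
  have hm1 : (1 : ℝ) ≤ m := by exact_mod_cast hm
  calc ∑ j ∈ J, c (f j) * (Real.log (min 1 (Y (j + 1) (f j))) - Real.log (min 1 (Y j (f j))))
      = ∑ i ∈ J.image f, ∑ j ∈ J with f j = i,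
          c i * (Real.log (min 1 (Y (j + 1) i)) - Real.log (min 1 (Y j i))) := by
        rw [← Finset.sum_fiberwise_of_maps_to (fun j hj => Finset.mem_image_of_mem f hj)]
        refine Finset.sum_congr rfl fun i _ => Finset.sum_congr rfl fun j hj => ?_
        rw [(Finset.mem_filter.1 hj).2]
    _ ≤ ∑ i ∈ J.image f, c i * Real.log m := by
        refine Finset.sum_le_sum fun i _ => ?_
        rw [← Finset.mul_sum]
        refine mul_le_mul_of_nonneg_left ?_ (hc i).le
        calc ∑ j ∈ J with f j = i, (Real.log (min 1 (Y (j + 1) i)) - Real.log (min 1 (Y j i)))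
            ≤ ∑ j ∈ J, (Real.log (min 1 (Y (j + 1) i)) - Real.log (min 1 (Y j i))) := by
              refine Finset.sum_le_sum_of_subset_of_nonneg (Finset.filter_subset _ _)
                fun j _ _ => sub_nonneg.2 (Real.log_le_log
                  (lt_min one_pos (H.weight_pos hm j.2.le i)) (min_le_min_left _ (H.le_succ j i)))
          _ = Real.log (min 1 (Y n i)) - Real.log (min 1 (Y 0 i)) :=
              sum_sub_eq_of_stay J Y H.stay fun y => Real.log (min 1 (y i))
          _ ≤ Real.log m := by
              have h1 : Real.log (min 1 (Y n i)) ≤ 0 :=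
                Real.log_nonpos (le_min zero_le_one (H.weight_pos hm le_rfl i).le)
                  (min_le_left _ _)
              have h2 : 1 / (m : ℝ) ≤ 1 := by rwa [div_le_one (by positivity)]
              have h3 : Real.log (1 / m) = -Real.log m := by rw [one_div, Real.log_inv]
              rw [H.start, min_eq_right h2]
              linarith
    _ = (∑ i ∈ J.image f, c i) * Real.log m := (Finset.sum_mul _ _ _).symm
    _ ≤ 2 * Real.log m := mul_le_mul_of_nonneg_right H.open_le (Real.log_nonneg hm1)

/-- The total price paid in an epoch is logarithmic. -/
theorem sum_price_le (H : IsRun c a p J F E Y τ f) (hm : 0 < m) :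
    ∑ j ∈ J, τ j ≤ 3 + 4 * Real.log m := by
  have h1 : ∑ j ∈ J, τ j ≤ ∑ j ∈ J, (a j (f j) + c (f j) * p j (f j) * max 1 (Y j (f j)) / 10
      + c (f j) * (Real.log (min 1 (Y (j + 1) (f j))) - Real.log (min 1 (Y j (f j))))) :=
    Finset.sum_le_sum fun j hj => (H.step j hj).price_le (f j) (H.mem j hj)
  rw [Finset.sum_add_distrib, Finset.sum_add_distrib] at h1
  -- With `T` the total price, `T ≤ 1 + (3 + 5 * T) / 10 + 2 * log m`. The divisor 10 in the price
  -- leaves only `T / 2` on the right, which is absorbed.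
  linarith [H.assign_le, H.sum_load_price_le hm, H.sum_log_increase_le hm, H.sum_charge_le]

theorem sum_charge_le_log (H : IsRun c a p J F E Y τ f) (hm : 0 < m) :
    ∑ i, c i * Y n i ≤ 16 + 20 * Real.log m := by
  linarith [H.sum_charge_le, H.sum_price_le hm]

/-- The demand that a facility would receive if it were given all the clients to which it is
offered is logarithmic. -/
theorem sum_offered_le (H : IsRun c a p J F E Y τ f) (hm : 0 < m) (i : Fin m) :
    ∑ j ∈ J with i ∈ E j, p j i ≤ 160 + 220 * Real.log m := by
  have hm1 : (1 : ℝ) ≤ m := by exact_mod_cast hm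
  have hm0 : (0 : ℝ) < m := by positivity
  have h1 : ∑ j ∈ J with i ∈ E j, p j i / 10 ≤ ∑ j ∈ J, (Real.log (Y (j + 1) i)
      - Real.log (Y j i)) := by
    rw [Finset.sum_filter]
    refine Finset.sum_le_sum fun j hj => ?_
    have hpos := H.weight_pos hm j.2.le i
    split_ifs with hi
    · have := Real.log_le_log (by positivity) ((H.step j hj).growth i hi)
      rw [Real.log_mul hpos.ne' (Real.exp_pos _).ne', Real.log_exp] at this
      linarith
    · exact sub_nonneg.2 (Real.log_le_log hpos (H.le_succ j i))
  rw [sum_sub_eq_of_stay J Y H.stay fun y => Real.log (y i), H.start, one_div, Real.log_inv,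
    ← Finset.sum_div] at h1
  have h2 : 1 / m * Y n i ≤ 16 + 20 * Real.log m := by
    refine le_trans ?_ (H.sum_charge_le_log hm)
    refine le_trans (mul_le_mul_of_nonneg_right (H.charge_ge i) (H.weight_pos hm le_rfl i).le) ?_
    exact Finset.single_le_sum (f := fun i => c i * Y n i)
      (fun k _ => (mul_pos (H.charge_pos hm k) (H.weight_pos hm le_rfl k)).le)
      (Finset.mem_univ i)
  have hpos := H.weight_pos hm le_rfl i
  have h3 : Real.log (Y n i) = Real.log m + Real.log (1 / m * Y n i) := by
    rw [← Real.log_mul hm0.ne' (by positivity)]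
    congr 1
    field_simp
  -- The crude `log x ≤ x - 1` is enough here, since `Y n i / m` is itself logarithmic.
  have h4 := Real.log_le_sub_one_of_pos (show 0 < 1 / (m : ℝ) * Y n i by positivity)
  linarith [Real.log_nonneg hm1]

end IsRun

end Run

/-! ### Random thresholds -/

section Thresholds

variable {m : ℕ}

/-- The law of independent thresholds, uniform in the unit interval. -/
noncomputable def thresholdMeasure (m : ℕ) : Measure (Fin m → ℝ) :=
  Measure.pi fun _ => volume.restrict (Set.Icc (0 : ℝ) 1)

instance isProbabilityMeasure_restrict_Icc :
    IsProbabilityMeasure ((volume : Measure ℝ).restrict (Set.Icc (0 : ℝ) 1)) :=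
  ⟨by simp⟩

instance isProbabilityMeasure_thresholdMeasure (m : ℕ) :
    IsProbabilityMeasure (thresholdMeasure m) := by
  unfold thresholdMeasure
  infer_instance

lemma measurableSet_threshold_le (i : Fin m) (t : ℝ) :
    MeasurableSet {ω : Fin m → ℝ | ω i ≤ t} :=
  measurableSet_le (measurable_pi_apply i) measurable_const

lemma thresholdMeasure_le (i : Fin m) {t : ℝ} (ht : 0 ≤ t) :
    (thresholdMeasure m).real {ω | ω i ≤ t} ≤ t := by
  have h1 : {ω : Fin m → ℝ | ω i ≤ t} = Function.eval i ⁻¹' Set.Iic t := rfl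
  have h2 := (measurePreserving_eval
    (fun _ : Fin m => (volume : Measure ℝ).restrict (Set.Icc (0 : ℝ) 1)) i).measure_preimage
    (measurableSet_Iic (a := t)).nullMeasurableSet
  rw [Measure.real, h1, thresholdMeasure, h2, Measure.restrict_apply measurableSet_Iic]
  refine ENNReal.toReal_le_of_le_ofReal ht ?_
  calc volume (Set.Iic t ∩ Set.Icc 0 1) ≤ volume (Set.Icc 0 t) :=
        measure_mono fun x hx => ⟨hx.2.1, hx.1⟩
    _ = ENNReal.ofReal t := by simp

lemma volume_restrict_Ioi_le {K t : ℝ} (hK : 1 ≤ K) :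
    (volume : Measure ℝ).restrict (Set.Icc (0 : ℝ) 1) (Set.Ioi (K * t))
      ≤ ENNReal.ofReal (Real.exp (-(K * min 1 t))) := by
  rw [Measure.restrict_apply measurableSet_Ioi]
  calc volume (Set.Ioi (K * t) ∩ Set.Icc 0 1) ≤ volume (Set.Icc (K * t) 1) :=
        measure_mono fun x hx => ⟨le_of_lt hx.1, hx.2.2⟩
    _ = ENNReal.ofReal (1 - K * t) := by simp
    _ ≤ _ := by
        refine ENNReal.ofReal_le_ofReal ?_
        have h1 := Real.add_one_le_exp (-(K * min 1 t))
        have h2 : K * min 1 t ≤ K * t :=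
          mul_le_mul_of_nonneg_left (min_le_right _ _) (by linarith)
        linarith

/-- Facilities of total truncated weight at least one, scaled up by `K`, all stay above their
thresholds with probability at most `exp (-K)`. -/
lemma thresholdMeasure_forall_lt_le {K : ℝ} (hK : 1 ≤ K) (E : Finset (Fin m)) (y : Fin m → ℝ)
    (hE : 1 ≤ ∑ i ∈ E, min 1 (y i)) :
    (thresholdMeasure m).real {ω | ∀ i ∈ E, K * y i < ω i} ≤ Real.exp (-K) := by
  have h1 : {ω : Fin m → ℝ | ∀ i ∈ E, K * y i < ω i}
      = Set.univ.pi fun i => if i ∈ E then Set.Ioi (K * y i) else Set.univ := by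
    ext ω
    simp only [Set.mem_ofPred_eq, Set.mem_pi, Set.mem_univ, true_imp_iff]
    refine forall_congr' fun i => ?_
    split_ifs with hi <;> simp [hi]
  rw [Measure.real, h1, thresholdMeasure, Measure.pi_pi]
  refine ENNReal.toReal_le_of_le_ofReal (Real.exp_pos _).le ?_
  calc ∏ i, (volume : Measure ℝ).restrict (Set.Icc (0 : ℝ) 1)
          (if i ∈ E then Set.Ioi (K * y i) else Set.univ)
      ≤ ∏ i, (if i ∈ E then ENNReal.ofReal (Real.exp (-(K * min 1 (y i)))) else 1) := by
        refine Finset.prod_le_prod' fun i _ => ?_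
        split_ifs
        · exact volume_restrict_Ioi_le hK
        · exact prob_le_one
    _ = ENNReal.ofReal (∏ i ∈ E, Real.exp (-(K * min 1 (y i)))) := by
        rw [Finset.prod_ite_mem, Finset.univ_inter,
          ENNReal.ofReal_prod_of_nonneg fun i _ => (Real.exp_pos _).le]
    _ ≤ ENNReal.ofReal (Real.exp (-K)) := by
        refine ENNReal.ofReal_le_ofReal ?_
        rw [← Real.exp_sum, Finset.sum_neg_distrib, ← Finset.mul_sum]
        exact Real.exp_le_exp.2 (neg_le_neg (le_mul_of_one_le_right (by linarith) hE))

lemma integral_threshold_indicator (s : Set (Fin m → ℝ)) (hs : MeasurableSet s) (b : ℝ) :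
    Integrable (s.indicator fun _ => b) (thresholdMeasure m) ∧
      ∫ ω, s.indicator (fun _ => b) ω ∂thresholdMeasure m = (thresholdMeasure m).real s * b :=
  ⟨(integrable_const b).indicator hs, by rw [integral_indicator_const b hs, smul_eq_mul]⟩

end Thresholds

/-! ### The online algorithm, its causality and measurability -/

section Algorithm

variable {m n : ℕ} (c u : Fin m → ℝ)

/-- The least cost of serving the first client alone. -/
noncomputable def initialZ (σ : Fin n → Client m) (j : Fin n) : ℝ :=
  ⨅ i, ccflSingle c u σ ⟨0, j.pos⟩ i

/-- The first epoch whose parameter is at least the least cost of serving the clients up to `j`. -/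
noncomputable def earliestEpoch (σ : Fin n → Client m) (j : Fin n) : ℕ :=
  sInf {k | ∃ f : Fin n → Fin m,
    ccflCost c u σ (Finset.Iic j) ((Finset.Iic j).image f) f ≤ 2 ^ k * initialZ c u σ j}

/-- The running maximum makes epochs monotone on every sequence, also on those that violate the sign
assumptions. -/
noncomputable def ccflEpoch (σ : Fin n → Client m) (j : Fin n) : ℕ :=
  (Finset.Iic j).sup (earliestEpoch c u σ)

/-- Fixed charges in units of `Z`, truncated to `[1 / m, 1]`. -/
noncomputable def normalizedCharge (Z : ℝ) (i : Fin m) : ℝ :=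
  max (min (c i / Z) 1) (1 / m)

/-- The facilities that can serve a client alone at a cost of at most `Z`. -/
noncomputable def affordable (Z : ℝ) (r : Client m) : Finset (Fin m) :=
  Finset.univ.filter fun i => c i + r.demand i / u i + r.assignCost i ≤ Z

def IsCcflStep (Z : ℝ) (r : Client m) (y : Fin m → ℝ) (s : (Fin m → ℝ) × Finset (Fin m))
    (τ : ℝ) : Prop :=
  IsStep (normalizedCharge c Z) (fun i => r.assignCost i / Z) (fun i => r.demand i / u i / Z)
    (affordable c u Z r) y s.1 s.2 τ

open Classical in
/-- The weights after a client with data `r` has been processed, and the facilities offered. -/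
noncomputable def ccflStep (Z : ℝ) (r : Client m) (y : Fin m → ℝ) :
    (Fin m → ℝ) × Finset (Fin m) :=
  -- The default is never reached on valid input with positive weights, by `exists_isCcflStep`.
  if h : ∃ s, ∃ τ, IsCcflStep c u Z r y s τ then h.choose else (y, ∅)

/-- The weights in epoch `k` after the first `t` clients. -/
noncomputable def ccflWeight (σ : Fin n → Client m) (k : ℕ) : ℕ → Fin m → ℝ
  | 0 => fun _ => 1 / m
  | t + 1 =>
    if h : t < n then
      if ccflEpoch c u σ ⟨t, h⟩ = k then
        (ccflStep c u (2 ^ k * initialZ c u σ ⟨t, h⟩) (σ ⟨t, h⟩) (ccflWeight σ k t)).1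
      else ccflWeight σ k t
    else ccflWeight σ k t

/-- The value of `Z` when client `j` arrives. -/
noncomputable def ccflZ (σ : Fin n → Client m) (j : Fin n) : ℝ :=
  2 ^ ccflEpoch c u σ j * initialZ c u σ j

/-- The facilities offered to client `j`. -/
noncomputable def offered (σ : Fin n → Client m) (j : Fin n) : Finset (Fin m) :=
  (ccflStep c u (ccflZ c u σ j) (σ j) (ccflWeight c u σ (ccflEpoch c u σ j) j)).2

/-- The offered facilities whose scaled weight has reached the threshold. -/
noncomputable def ready (ω : Fin m → ℝ) (σ : Fin n → Client m) (j : Fin n) : Finset (Fin m) :=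
  (offered c u σ j).filter fun i =>
    ω i ≤ Real.log (m * n) * ccflWeight c u σ (ccflEpoch c u σ j) (j + 1) i

open Classical in
/-- A facility in `s` if there is one, otherwise one that is affordable for client `j`. -/
noncomputable def pickFacility (i₀ : Fin m) (σ : Fin n → Client m) (j : Fin n)
    (s : Finset (Fin m)) : Fin m :=
  if h : s.Nonempty then h.choose
  else if h : (affordable c u (ccflZ c u σ j) (σ j)).Nonempty then h.choose else i₀

noncomputable def ccflTarget (i₀ : Fin m) (ω : Fin m → ℝ) (σ : Fin n → Client m) (j : Fin n) :
    Fin m :=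
  pickFacility c u i₀ σ j (ready c u ω σ j)

variable {c u}

section Online

variable {σ τ : Fin n → Client m} {j : Fin n}

lemma ccflSingle_congr {k : Fin n} (hk : σ k = τ k) : ccflSingle c u σ k = ccflSingle c u τ k := by
  funext i
  simp [ccflSingle, hk]

lemma ccflCost_congr {J : Finset (Fin n)} (hJ : ∀ k ∈ J, σ k = τ k) (O : Finset (Fin m))
    (f : Fin n → Fin m) : ccflCost c u σ J O f = ccflCost c u τ J O f := by
  unfold ccflCost
  congr 1
  · congr 1
    refine iSup_congr fun i => ?_
    congr 1
    exact Finset.sum_congr rfl fun k hk => by rw [hJ k (Finset.mem_filter.1 hk).1]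
  · exact Finset.sum_congr rfl fun k hk => by rw [hJ k hk]

lemma initialZ_congr (h : ∀ k ≤ j, σ k = τ k) : initialZ c u σ j = initialZ c u τ j := by
  unfold initialZ
  rw [ccflSingle_congr (h _ (Fin.mk_le_of_le_val (Nat.zero_le _)))]

lemma earliestEpoch_congr (h : ∀ k ≤ j, σ k = τ k) : earliestEpoch c u σ j = earliestEpoch c u τ j := by
  unfold earliestEpoch
  simp only [initialZ_congr h, ccflCost_congr (fun k hk => h k (Finset.mem_Iic.1 hk))]

lemma ccflEpoch_congr (h : ∀ k ≤ j, σ k = τ k) : ccflEpoch c u σ j = ccflEpoch c u τ j :=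
  Finset.sup_congr rfl fun _ hk =>
    earliestEpoch_congr fun l hl => h l (hl.trans (Finset.mem_Iic.1 hk))

lemma ccflZ_congr (h : ∀ k ≤ j, σ k = τ k) : ccflZ c u σ j = ccflZ c u τ j := by
  rw [ccflZ, ccflZ, ccflEpoch_congr h, initialZ_congr h]

lemma ccflWeight_congr (k : ℕ) {t : ℕ} (h : ∀ l : Fin n, l.1 < t → σ l = τ l) :
    ccflWeight c u σ k t = ccflWeight c u τ k t := by
  induction t with
  | zero => rfl
  | succ t ih =>
    have ih' := ih fun l hl => h l (by omega)
    unfold ccflWeight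
    split_ifs with ht h1 h2 h2
    · have hl : ∀ l ≤ (⟨t, ht⟩ : Fin n), σ l = τ l := fun l hl => h l (Nat.lt_succ_of_le hl)
      rw [ih', initialZ_congr hl, hl _ le_rfl]
    · exact absurd (ccflEpoch_congr fun l hl => h l (Nat.lt_succ_of_le hl))
        (by rw [h1]; exact fun e => h2 e.symm)
    · exact absurd (ccflEpoch_congr fun l hl => h l (Nat.lt_succ_of_le hl))
        (by rw [h2]; exact h1)
    · exact ih'
    · exact ih'

lemma offered_congr (h : ∀ k ≤ j, σ k = τ k) : offered c u σ j = offered c u τ j := by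
  rw [offered, offered, ccflEpoch_congr h, ccflZ_congr h, h j le_rfl,
    ccflWeight_congr _ fun l hl => h l (le_of_lt hl)]

lemma ready_congr (ω : Fin m → ℝ) (h : ∀ k ≤ j, σ k = τ k) :
    ready c u ω σ j = ready c u ω τ j := by
  rw [ready, ready, offered_congr h, ccflEpoch_congr h,
    ccflWeight_congr _ fun l hl => h l (Nat.le_of_lt_succ hl)]

lemma ccflTarget_congr (i₀ : Fin m) (ω : Fin m → ℝ) (h : ∀ k ≤ j, σ k = τ k) :
    ccflTarget c u i₀ ω σ j = ccflTarget c u i₀ ω τ j := by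
  rw [ccflTarget, ccflTarget, ready_congr ω h]
  unfold pickFacility
  simp only [ccflZ_congr h, h j le_rfl]

end Online

lemma measurableSet_ready (σ : Fin n → Client m) (j : Fin n) (s : Finset (Fin m)) :
    MeasurableSet {ω | ready c u ω σ j = s} := by
  have h : {ω | ready c u ω σ j = s} = ⋂ i, {ω | i ∈ ready c u ω σ j ↔ i ∈ s} := by
    ext ω
    simp [Finset.ext_iff]
  rw [h]
  refine MeasurableSet.iInter fun i => MeasurableSet.iff ?_ (MeasurableSet.const _)
  simp only [ready, Finset.mem_filter]
  exact MeasurableSet.inter (MeasurableSet.const _) (measurableSet_threshold_le i _)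

lemma measurableSet_ccflTarget (i₀ : Fin m) (σ : Fin n → Client m) (j : Fin n)
    (S : Set (Fin m)) : MeasurableSet {ω | ccflTarget c u i₀ ω σ j ∈ S} := by
  have h : {ω | ccflTarget c u i₀ ω σ j ∈ S}
      = ⋃ s ∈ {s | pickFacility c u i₀ σ j s ∈ S}, {ω | ready c u ω σ j = s} := by
    ext ω
    simp [ccflTarget]
  rw [h]
  exact MeasurableSet.biUnion (Set.to_countable _) fun s _ => measurableSet_ready σ j s

variable (c u) in
/-- The online algorithm for capacity-constrained facility location. -/
noncomputable def ccflAlgorithm (i₀ : Fin m) : EpochAlgorithm (Client m) m n where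
  Ω := Fin m → ℝ
  μ := thresholdMeasure m
  epoch := ccflEpoch c u
  newOpen ω σ j := {ccflTarget c u i₀ ω σ j}
  target := ccflTarget c u i₀
  epoch_online _ _ _ h := ccflEpoch_congr h
  newOpen_online ω _ _ _ h := by rw [ccflTarget_congr i₀ ω h]
  target_online ω _ _ _ h := ccflTarget_congr i₀ ω h
  epoch_monotone _ _ _ h := Finset.sup_mono (Finset.Iic_subset_Iic.2 h)
  target_open _ _ j := ⟨j, le_rfl, rfl, Finset.mem_singleton_self _⟩
  measurableSet_newOpen σ j s := measurableSet_ccflTarget i₀ σ j {i | {i} = s}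
  measurableSet_target σ j i := measurableSet_ccflTarget i₀ σ j {i}

end Algorithm

/-! ### Valid inputs: cost estimates, the choice of `Z`, and epochs as runs -/

section Input

variable {m n : ℕ}

/-- A request sequence that satisfies the assumptions of the problem. -/
structure ValidInput (c u : Fin m → ℝ) (σ : Fin n → Client m) : Prop where
  charge_nonneg : ∀ i, 0 ≤ c i
  capacity_pos : ∀ i, 0 < u i
  demand_nonneg : ∀ j i, 0 ≤ (σ j).demand i
  assign_nonneg : ∀ j i, 0 ≤ (σ j).assignCost i
  single_pos : ∀ j i, 0 < ccflSingle c u σ j i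

namespace ValidInput

variable {c u : Fin m → ℝ} {σ : Fin n → Client m}

lemma congestion_nonneg (H : ValidInput c u σ) (J : Finset (Fin n)) (f : Fin n → Fin m)
    (i : Fin m) : 0 ≤ (∑ j ∈ J with f j = i, (σ j).demand i) / u i :=
  div_nonneg (Finset.sum_nonneg fun j _ => H.demand_nonneg j i) (H.capacity_pos i).le

lemma iSup_congestion_nonneg (H : ValidInput c u σ) (J : Finset (Fin n)) (f : Fin n → Fin m) :
    0 ≤ ⨆ i, (∑ j ∈ J with f j = i, (σ j).demand i) / u i :=
  Real.iSup_nonneg fun i => H.congestion_nonneg J f i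

lemma sum_charge_nonneg (H : ValidInput c u σ) (O : Finset (Fin m)) : 0 ≤ ∑ i ∈ O, c i :=
  Finset.sum_nonneg fun i _ => H.charge_nonneg i

lemma sum_assign_nonneg (H : ValidInput c u σ) (J : Finset (Fin n)) (f : Fin n → Fin m) :
    0 ≤ ∑ j ∈ J, (σ j).assignCost (f j) :=
  Finset.sum_nonneg fun j _ => H.assign_nonneg j _

lemma cost_nonneg (H : ValidInput c u σ) (J : Finset (Fin n)) (O : Finset (Fin m))
    (f : Fin n → Fin m) : 0 ≤ ccflCost c u σ J O f :=
  add_nonneg (add_nonneg (H.iSup_congestion_nonneg J f) (H.sum_charge_nonneg O))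
    (H.sum_assign_nonneg J f)

lemma cost_mono (H : ValidInput c u σ) {J J' : Finset (Fin n)} (hJ : J ⊆ J')
    {O O' : Finset (Fin m)} (hO : O ⊆ O') (f : Fin n → Fin m) :
    ccflCost c u σ J O f ≤ ccflCost c u σ J' O' f := by
  refine add_le_add (add_le_add ?_ ?_) ?_
  · refine ciSup_mono (Set.finite_range _).bddAbove fun i => ?_
    refine div_le_div_of_nonneg_right ?_ (H.capacity_pos i).le
    exact Finset.sum_le_sum_of_subset_of_nonneg (Finset.filter_subset_filter _ hJ)
      fun j _ _ => H.demand_nonneg j i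
  · exact Finset.sum_le_sum_of_subset_of_nonneg hO fun i _ _ => H.charge_nonneg i
  · exact Finset.sum_le_sum_of_subset_of_nonneg hJ fun j _ _ => H.assign_nonneg j _

lemma congestion_le_cost (H : ValidInput c u σ) (J : Finset (Fin n)) (O : Finset (Fin m))
    (f : Fin n → Fin m) (i : Fin m) :
    (∑ j ∈ J with f j = i, (σ j).demand i) / u i ≤ ccflCost c u σ J O f := by
  have h := le_ciSup (Set.finite_range fun i =>
    (∑ j ∈ J with f j = i, (σ j).demand i) / u i).bddAbove i
  unfold ccflCost
  linarith [H.sum_charge_nonneg O, H.sum_assign_nonneg J f]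

lemma charge_le_cost (H : ValidInput c u σ) (J : Finset (Fin n)) (O : Finset (Fin m))
    (f : Fin n → Fin m) : ∑ i ∈ O, c i ≤ ccflCost c u σ J O f := by
  unfold ccflCost
  linarith [H.iSup_congestion_nonneg J f, H.sum_assign_nonneg J f]

lemma assign_le_cost (H : ValidInput c u σ) (J : Finset (Fin n)) (O : Finset (Fin m))
    (f : Fin n → Fin m) : ∑ j ∈ J, (σ j).assignCost (f j) ≤ ccflCost c u σ J O f := by
  unfold ccflCost
  linarith [H.iSup_congestion_nonneg J f, H.sum_charge_nonneg O]

lemma single_le_cost (H : ValidInput c u σ) {J : Finset (Fin n)} {O : Finset (Fin m)}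
    {f : Fin n → Fin m} {j : Fin n} (hj : j ∈ J) (hO : f j ∈ O) :
    ccflSingle c u σ j (f j) ≤ ccflCost c u σ J O f := by
  have h1 : (σ j).demand (f j) / u (f j)
      ≤ ⨆ i, (∑ j ∈ J with f j = i, (σ j).demand i) / u i := by
    refine le_trans ?_ (le_ciSup (Set.finite_range fun i =>
      (∑ j ∈ J with f j = i, (σ j).demand i) / u i).bddAbove (f j))
    refine div_le_div_of_nonneg_right ?_ (H.capacity_pos _).le
    exact Finset.single_le_sum (f := fun k => (σ k).demand (f j))
      (fun k _ => H.demand_nonneg k _) (Finset.mem_filter.2 ⟨hj, rfl⟩)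
  have h2 : c (f j) ≤ ∑ i ∈ O, c i :=
    Finset.single_le_sum (fun i _ => H.charge_nonneg i) hO
  have h3 : (σ j).assignCost (f j) ≤ ∑ j ∈ J, (σ j).assignCost (f j) :=
    Finset.single_le_sum (f := fun k => (σ k).assignCost (f k))
      (fun k _ => H.assign_nonneg k _) hj
  unfold ccflSingle ccflCost
  linarith

lemma initialZ_pos (H : ValidInput c u σ) (hm : 0 < m) (j : Fin n) : 0 < initialZ c u σ j := by
  have : Nonempty (Fin m) := ⟨⟨0, hm⟩⟩
  obtain ⟨i, hi⟩ := exists_eq_ciInf_of_finite (f := ccflSingle c u σ ⟨0, j.pos⟩)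
  rw [initialZ, ← hi]
  exact H.single_pos _ i

lemma ccflZ_pos (H : ValidInput c u σ) (hm : 0 < m) (j : Fin n) : 0 < ccflZ c u σ j :=
  mul_pos (by positivity) (H.initialZ_pos hm j)

lemma exists_cost_le_ccflZ (H : ValidInput c u σ) (hm : 0 < m) (j : Fin n) :
    ∃ f : Fin n → Fin m,
      ccflCost c u σ (Finset.Iic j) ((Finset.Iic j).image f) f ≤ ccflZ c u σ j := by
  have hz := H.initialZ_pos hm j
  have hne : {k | ∃ f : Fin n → Fin m, ccflCost c u σ (Finset.Iic j) ((Finset.Iic j).image f) f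
      ≤ 2 ^ k * initialZ c u σ j}.Nonempty := by
    let f : Fin n → Fin m := fun _ => ⟨0, hm⟩
    obtain ⟨k, hk⟩ := pow_unbounded_of_one_lt
      (ccflCost c u σ (Finset.Iic j) ((Finset.Iic j).image f) f / initialZ c u σ j)
      (one_lt_two (α := ℝ))
    exact ⟨k, f, ((div_lt_iff₀ hz).1 hk).le⟩
  obtain ⟨f, hf⟩ := Nat.sInf_mem hne
  refine ⟨f, hf.trans (mul_le_mul_of_nonneg_right ?_ hz.le)⟩
  exact pow_le_pow_right₀ one_le_two
    (Finset.le_sup (f := earliestEpoch c u σ) (Finset.mem_Iic.2 le_rfl))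

lemma ccflZ_le_two_mul_opt (H : ValidInput c u σ) (hm : 0 < m) (j : Fin n) :
    ccflZ c u σ j ≤ 2 * ccflOpt c u σ := by
  have : Nonempty (Fin m) := ⟨⟨0, hm⟩⟩
  obtain ⟨k, -, hk⟩ := Finset.exists_mem_eq_sup (Finset.Iic j) ⟨j, Finset.mem_Iic.2 le_rfl⟩
    (earliestEpoch c u σ)
  have hopt : ∀ z, (∀ f, z ≤ ccflCost c u σ Finset.univ (Finset.univ.image f) f) →
      z ≤ ccflOpt c u σ := fun z hz => le_ciInf hz
  rw [ccflZ, ccflEpoch, hk]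
  -- In epoch zero, `Z` is the cheapest service of the first client alone. Otherwise half of `Z` was
  -- too small for the clients up to `k`, so the optimum exceeds it.
  rcases h : earliestEpoch c u σ k with _ | l
  · have h1 : initialZ c u σ j ≤ ccflOpt c u σ := hopt _ fun f =>
      (ciInf_le (Set.finite_range _).bddBelow (f ⟨0, j.pos⟩)).trans
        (H.single_le_cost (Finset.mem_univ _) (Finset.mem_image_of_mem f (Finset.mem_univ _)))
    linarith [H.initialZ_pos hm j]
  · have h1 : 2 ^ l * initialZ c u σ j ≤ ccflOpt c u σ := hopt _ fun f => by
      have hl : l < earliestEpoch c u σ k := by omega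
      have hnot := Nat.notMem_of_lt_sInf hl
      have hlt : ¬ ccflCost c u σ (Finset.Iic k) ((Finset.Iic k).image f) f
          ≤ 2 ^ l * initialZ c u σ k := fun h => hnot ⟨f, h⟩
      exact (not_le.1 hlt).le.trans
        (H.cost_mono (Finset.subset_univ _) (Finset.image_subset_image (Finset.subset_univ _)) f)
    rw [pow_succ]
    linarith

lemma mem_affordable {Z : ℝ} {j : Fin n} {i : Fin m} :
    i ∈ affordable c u Z (σ j) ↔ ccflSingle c u σ j i ≤ Z := by
  simp [affordable, ccflSingle]

lemma affordable_nonempty (H : ValidInput c u σ) (hm : 0 < m) (j : Fin n) :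
    (affordable c u (ccflZ c u σ j) (σ j)).Nonempty := by
  obtain ⟨f, hf⟩ := H.exists_cost_le_ccflZ hm j
  have hj := Finset.mem_Iic.2 (le_refl j)
  exact ⟨f j, mem_affordable.2 ((H.single_le_cost hj (Finset.mem_image_of_mem f hj)).trans hf)⟩

lemma parts_le_of_affordable (H : ValidInput c u σ) {Z : ℝ} {j : Fin n} {i : Fin m}
    (h : i ∈ affordable c u Z (σ j)) :
    c i ≤ Z ∧ (σ j).demand i / u i ≤ Z ∧ (σ j).assignCost i ≤ Z := by
  have h0 := mem_affordable.1 h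
  unfold ccflSingle at h0
  have h1 := H.charge_nonneg i
  have h2 := div_nonneg (H.demand_nonneg j i) (H.capacity_pos i).le
  have h3 := H.assign_nonneg j i
  exact ⟨by linarith, by linarith, by linarith⟩

lemma normalizedCharge_pos (hm : 0 < m) (Z : ℝ) (i : Fin m) : 0 < normalizedCharge c Z i :=
  lt_of_lt_of_le (by positivity) (le_max_right _ _)

lemma exists_isCcflStep (H : ValidInput c u σ) (hm : 0 < m) (j : Fin n) {y : Fin m → ℝ}
    (hy : ∀ i, 0 < y i) :
    ∃ τ, IsCcflStep c u (ccflZ c u σ j) (σ j) y (ccflStep c u (ccflZ c u σ j) (σ j) y) τ := by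
  have hZ := H.ccflZ_pos hm j
  have hex : ∃ s, ∃ τ, IsCcflStep c u (ccflZ c u σ j) (σ j) y s τ := by
    obtain ⟨y', E, τ, h⟩ := exists_isStep (normalizedCharge c (ccflZ c u σ j))
      (fun i => (σ j).assignCost i / ccflZ c u σ j)
      (fun i => (σ j).demand i / u i / ccflZ c u σ j) y _ (H.affordable_nonempty hm j)
      (normalizedCharge_pos hm _) hy
      (fun i _ => div_nonneg (H.assign_nonneg j i) hZ.le)
      (fun i _ => div_nonneg (div_nonneg (H.demand_nonneg j i) (H.capacity_pos i).le) hZ.le)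
      (fun i hi => (div_le_one hZ).2 (H.parts_le_of_affordable hi).2.1)
    exact ⟨(y', E), τ, h⟩
  rw [ccflStep, dif_pos hex]
  exact hex.choose_spec

lemma ccflWeight_succ (σ : Fin n → Client m) (j : Fin n) :
    ccflWeight c u σ (ccflEpoch c u σ j) (j + 1)
      = (ccflStep c u (ccflZ c u σ j) (σ j) (ccflWeight c u σ (ccflEpoch c u σ j) j)).1 := by
  rw [ccflWeight, dif_pos j.2, if_pos rfl]
  rfl

lemma ccflWeight_succ_of_ne (σ : Fin n → Client m) {j : Fin n} {k : ℕ}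
    (h : ccflEpoch c u σ j ≠ k) : ccflWeight c u σ k (j + 1) = ccflWeight c u σ k j := by
  rw [ccflWeight, dif_pos j.2, if_neg h]

lemma ccflWeight_pos (H : ValidInput c u σ) (hm : 0 < m) (k t : ℕ) (i : Fin m) :
    0 < ccflWeight c u σ k t i := by
  induction t generalizing i with
  | zero => rw [ccflWeight]; positivity
  | succ t ih =>
    by_cases ht : t < n
    · by_cases hk : ccflEpoch c u σ ⟨t, ht⟩ = k
      · subst hk
        rw [ccflWeight_succ σ ⟨t, ht⟩]
        obtain ⟨τ, h⟩ := H.exists_isCcflStep hm ⟨t, ht⟩ ih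
        exact (ih i).trans_le (h.le_next i)
      · rw [ccflWeight_succ_of_ne σ (j := ⟨t, ht⟩) hk]
        exact ih i
    · rw [ccflWeight, dif_neg ht]
      exact ih i

/-- Truncation from below adds at most `1 / m` per facility, hence at most one in total. -/
lemma sum_normalizedCharge_le (H : ValidInput c u σ) {Z : ℝ} (hZ : 0 < Z) {O : Finset (Fin m)}
    (hO : ∑ i ∈ O, c i ≤ Z) : ∑ i ∈ O, normalizedCharge c Z i ≤ 2 := by
  have h1 : ∀ i, normalizedCharge c Z i ≤ c i / Z + 1 / m := fun i => by
    have : 0 ≤ c i / Z := div_nonneg (H.charge_nonneg i) hZ.le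
    have hm' : (0 : ℝ) ≤ 1 / m := by positivity
    exact max_le ((min_le_left _ _).trans (by linarith)) (by linarith)
  have h2 : (O.card : ℝ) ≤ m := by
    exact_mod_cast (Finset.card_le_univ O).trans_eq (Fintype.card_fin m)
  calc ∑ i ∈ O, normalizedCharge c Z i ≤ ∑ i ∈ O, (c i / Z + 1 / m) :=
        Finset.sum_le_sum fun i _ => h1 i
    _ = (∑ i ∈ O, c i) / Z + O.card / m := by
        rw [Finset.sum_add_distrib, Finset.sum_div, Finset.sum_const, nsmul_eq_mul,
          mul_one_div]
    _ ≤ 1 + 1 := add_le_add ((div_le_one hZ).2 hO)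
        (div_le_one_of_le₀ h2 (Nat.cast_nonneg m))
    _ = 2 := by norm_num

/-- Every nonempty epoch is a run of the fractional algorithm. -/
theorem exists_isRun (H : ValidInput c u σ) (hm : 0 < m) (j₀ : Fin n) :
    ∃ τ f, IsRun (normalizedCharge c (ccflZ c u σ j₀))
      (fun j i => (σ j).assignCost i / ccflZ c u σ j₀)
      (fun j i => (σ j).demand i / u i / ccflZ c u σ j₀)
      (Finset.univ.filter fun j => ccflEpoch c u σ j = ccflEpoch c u σ j₀)
      (fun j => affordable c u (ccflZ c u σ j₀) (σ j)) (offered c u σ)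
      (ccflWeight c u σ (ccflEpoch c u σ j₀)) τ f := by
  set Z := ccflZ c u σ j₀ with hZdef
  set J := Finset.univ.filter fun j => ccflEpoch c u σ j = ccflEpoch c u σ j₀ with hJ
  have hZ : 0 < Z := H.ccflZ_pos hm j₀
  have hZj : ∀ j ∈ J, ccflZ c u σ j = Z := fun j hj => by
    rw [hZdef, ccflZ, ccflZ, (Finset.mem_filter.1 hj).2]; rfl
  have hJne : J.Nonempty := ⟨j₀, by simp [hJ]⟩
  -- The comparison solution is the one that justifies `Z` at the last client of the epoch; it
  -- serves all the earlier clients too.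
  obtain ⟨f, hf⟩ := H.exists_cost_le_ccflZ hm (J.max' hJne)
  rw [hZj _ (J.max'_mem hJne)] at hf
  have hsub : J ⊆ Finset.Iic (J.max' hJne) := fun j hj => Finset.mem_Iic.2 (J.le_max' j hj)
  have hcost : ccflCost c u σ J (J.image f) f ≤ Z :=
    (H.cost_mono hsub (Finset.image_subset_image hsub) f).trans hf
  have hstep := fun j => H.exists_isCcflStep hm j
    (y := ccflWeight c u σ (ccflEpoch c u σ j) j) (H.ccflWeight_pos hm _ _)
  choose τ hτ using hstep
  refine ⟨τ, f, fun i => le_max_right _ _, fun i => max_le (min_le_right _ _) ?_, ?_, fun i => rfl,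
    ?_, ?_, ?_, ?_, ?_, ?_⟩
  · rw [div_le_one (by positivity)]
    exact_mod_cast hm
  · exact fun j i => div_nonneg (div_nonneg (H.demand_nonneg j i) (H.capacity_pos i).le) hZ.le
  · intro j hj
    have h := hτ j
    have he := (Finset.mem_filter.1 hj).2
    rw [← he, ccflWeight_succ, offered]
    rw [hZj j hj] at h ⊢
    exact h
  · intro j hj
    exact ccflWeight_succ_of_ne σ (by simpa [hJ] using hj)
  · exact fun j hj => mem_affordable.2
      ((H.single_le_cost hj (Finset.mem_image_of_mem f hj)).trans hcost)
  · intro i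
    rw [← Finset.sum_div, ← Finset.sum_div]
    exact (div_le_one hZ).2 ((H.congestion_le_cost J _ f i).trans hcost)
  · rw [← Finset.sum_div]
    exact (div_le_one hZ).2 ((H.assign_le_cost J _ f).trans hcost)
  · exact H.sum_normalizedCharge_le hZ ((H.charge_le_cost J _ f).trans hcost)

end ValidInput

end Input

/-! ### Expected cost of one epoch after rounding -/

lemma sum_biUnion_le_of_nonneg {ι κ : Type*} [DecidableEq ι] (s : Finset κ)
    (t : κ → Finset ι) (g : ι → ℝ) (hg : ∀ i, 0 ≤ g i) :
    ∑ i ∈ s.biUnion t, g i ≤ ∑ k ∈ s, ∑ i ∈ t k, g i := by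
  classical
  induction s using Finset.induction_on with
  | empty => simp
  | insert k s hk ih =>
    rw [Finset.biUnion_insert, Finset.sum_insert hk]
    have h1 := Finset.sum_union_inter (s₁ := t k) (s₂ := s.biUnion t) (f := g)
    have h2 : 0 ≤ ∑ i ∈ t k ∩ s.biUnion t, g i := Finset.sum_nonneg fun i _ => hg i
    linarith

lemma one_le_log_mul {m n : ℕ} (hm : 2 ≤ m) (hn : 2 ≤ n) : 1 ≤ Real.log (m * n) := by
  have h2 : (2 : ℝ) ≤ m := by exact_mod_cast hm
  have h3 : (2 : ℝ) ≤ n := by exact_mod_cast hn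
  rw [Real.le_log_iff_exp_le (by positivity)]
  nlinarith [Real.exp_one_lt_d9]

namespace ValidInput

variable {m n : ℕ} {c u : Fin m → ℝ} {σ : Fin n → Client m}

lemma offered_subset (H : ValidInput c u σ) (hm : 0 < m) (j : Fin n) :
    offered c u σ j ⊆ affordable c u (ccflZ c u σ j) (σ j) := by
  obtain ⟨τ, h⟩ := H.exists_isCcflStep hm j (y := ccflWeight c u σ (ccflEpoch c u σ j) j)
    (H.ccflWeight_pos hm _ _)
  exact h.subset

lemma ccflTarget_mem_ready (i₀ : Fin m) {ω : Fin m → ℝ} {j : Fin n}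
    (h : (ready c u ω σ j).Nonempty) : ccflTarget c u i₀ ω σ j ∈ ready c u ω σ j := by
  rw [ccflTarget, pickFacility, dif_pos h]
  exact h.choose_spec

lemma ccflTarget_mem_affordable (H : ValidInput c u σ) (hm : 0 < m) (i₀ : Fin m) (ω : Fin m → ℝ)
    (j : Fin n) : ccflTarget c u i₀ ω σ j ∈ affordable c u (ccflZ c u σ j) (σ j) := by
  by_cases h : (ready c u ω σ j).Nonempty
  · exact H.offered_subset hm j (Finset.mem_filter.1 (ccflTarget_mem_ready i₀ h)).1
  · have h' := H.affordable_nonempty hm j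
    rw [ccflTarget, pickFacility, dif_neg h, dif_pos h']
    exact h'.choose_spec

lemma le_mul_normalizedCharge {Z : ℝ} (hZ : 0 < Z) {i : Fin m} (h : c i ≤ Z) :
    c i ≤ Z * normalizedCharge c Z i := by
  have h1 : c i / Z ≤ normalizedCharge c Z i :=
    (le_min le_rfl ((div_le_one hZ).2 h)).trans (le_max_left _ _)
  rwa [div_le_iff₀' hZ] at h1

variable (c u σ) in
/-- The thresholds for which no facility that is offered to client `j` is ready. -/
def missed (j : Fin n) : Set (Fin m → ℝ) :=
  {ω | ∀ i ∈ offered c u σ j,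
    Real.log (m * n) * ccflWeight c u σ (ccflEpoch c u σ j) (j + 1) i < ω i}

lemma measurableSet_missed (j : Fin n) : MeasurableSet (missed c u σ j) := by
  have h : missed c u σ j = {ω | ready c u ω σ j = ∅} := by
    ext ω
    simp [missed, ready, Finset.filter_eq_empty_iff]
  rw [h]
  exact measurableSet_ready σ j ∅

lemma ready_nonempty {ω : Fin m → ℝ} {j : Fin n} (h : ω ∉ missed c u σ j) :
    (ready c u ω σ j).Nonempty := by
  simp only [missed, Set.mem_ofPred_eq, not_forall, not_lt] at h
  obtain ⟨i, hi, hle⟩ := h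
  exact ⟨i, Finset.mem_filter.2 ⟨hi, hle⟩⟩

section EpochCost

variable (c u σ) in
/-- The clients in the epoch of client `j₀`. -/
noncomputable def epochMates (j₀ : Fin n) : Finset (Fin n) :=
  Finset.univ.filter fun j => ccflEpoch c u σ j = ccflEpoch c u σ j₀

lemma ccflZ_eq_of_mem {j₀ j : Fin n} (hj : j ∈ epochMates c u σ j₀) :
    ccflZ c u σ j = ccflZ c u σ j₀ := by
  rw [ccflZ, ccflZ, (Finset.mem_filter.1 hj).2]
  rfl

/-- The number of clients in the epoch of `j₀` that are missed, times `Z`. -/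
noncomputable def missedCost (c u : Fin m → ℝ) (σ : Fin n → Client m) (j₀ : Fin n)
    (ω : Fin m → ℝ) : ℝ :=
  ∑ j ∈ epochMates c u σ j₀, (missed c u σ j).indicator (fun _ => ccflZ c u σ j₀) ω

/-- Weights grow within the epoch, so every facility that was ever ready passes the test with the
final weight. -/
noncomputable def openingBound (c u : Fin m → ℝ) (σ : Fin n → Client m) (j₀ : Fin n)
    (ω : Fin m → ℝ) : ℝ :=
  ∑ i, {ω : Fin m → ℝ | ω i ≤
    Real.log (m * n) * ccflWeight c u σ (ccflEpoch c u σ j₀) n i}.indicator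
      (fun _ => ccflZ c u σ j₀ * normalizedCharge c (ccflZ c u σ j₀) i) ω

noncomputable def assignBound (c u : Fin m → ℝ) (σ : Fin n → Client m) (j₀ : Fin n)
    (ω : Fin m → ℝ) : ℝ :=
  ∑ j ∈ epochMates c u σ j₀, ∑ i ∈ offered c u σ j, {ω : Fin m → ℝ | ω i ≤
    Real.log (m * n) * ccflWeight c u σ (ccflEpoch c u σ j) (j + 1) i}.indicator
      (fun _ => (σ j).assignCost i) ω

/-- Clients that are not missed go to a facility offered to them, so `sum_offered_le` bounds their
load for every `ω`. A missed client still goes to an affordable facility and adds at most `Z`. -/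
lemma iSup_congestion_le (H : ValidInput c u σ) (hm : 0 < m) (i₀ : Fin m) (j₀ : Fin n)
    (ω : Fin m → ℝ) :
    ⨆ i, (∑ j ∈ epochMates c u σ j₀ with ccflTarget c u i₀ ω σ j = i, (σ j).demand i) / u i
      ≤ ccflZ c u σ j₀ * (160 + 220 * Real.log m) + missedCost c u σ j₀ ω := by
  have : Nonempty (Fin m) := ⟨i₀⟩
  have hZ := H.ccflZ_pos hm j₀
  obtain ⟨τ, f, R⟩ := H.exists_isRun hm j₀
  refine ciSup_le fun i => ?_
  have h1 := mul_le_mul_of_nonneg_left (R.sum_offered_le hm i) hZ.le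
  refine le_trans ?_ (add_le_add_left h1 _)
  rw [← Finset.sum_div, mul_div_cancel₀ _ hZ.ne', missedCost, Finset.sum_div, Finset.sum_filter,
    Finset.sum_filter]
  change _ ≤ ∑ j ∈ epochMates c u σ j₀, _ + _
  rw [← Finset.sum_add_distrib]
  refine Finset.sum_le_sum fun j hj => ?_
  have hd : 0 ≤ (σ j).demand i / u i := div_nonneg (H.demand_nonneg j i) (H.capacity_pos i).le
  have hpos : 0 ≤ (if i ∈ offered c u σ j then (σ j).demand i / u i else 0) := by
    split_ifs <;> simp [hd]
  have hind : 0 ≤ (missed c u σ j).indicator (fun _ => ccflZ c u σ j₀) ω :=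
    Set.indicator_nonneg (fun _ _ => hZ.le) _
  by_cases ht : ccflTarget c u i₀ ω σ j = i
  · rw [if_pos ht]
    by_cases hω : ω ∈ missed c u σ j
    · rw [Set.indicator_of_mem hω]
      have h2 := (H.parts_le_of_affordable (H.ccflTarget_mem_affordable hm i₀ ω j)).2.1
      rw [ht, ccflZ_eq_of_mem hj] at h2
      linarith
    · have h2 := (Finset.mem_filter.1 (ccflTarget_mem_ready i₀ (ready_nonempty hω))).1
      rw [ht] at h2
      rw [if_pos h2]
      linarith
  · rw [if_neg ht]
    exact add_nonneg hpos hind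

lemma sum_opening_le (H : ValidInput c u σ) (hm : 0 < m) (hn : 0 ≤ Real.log (m * n)) (i₀ : Fin m)
    (j₀ : Fin n) (ω : Fin m → ℝ) :
    ∑ i ∈ (epochMates c u σ j₀).biUnion fun j => {ccflTarget c u i₀ ω σ j}, c i
      ≤ openingBound c u σ j₀ ω + missedCost c u σ j₀ ω := by
  classical
  have hZ := H.ccflZ_pos hm j₀
  obtain ⟨τ, f, R⟩ := H.exists_isRun hm j₀
  set J := epochMates c u σ j₀
  set A := Finset.univ.filter fun i => c i ≤ ccflZ c u σ j₀ ∧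
    ω i ≤ Real.log (m * n) * ccflWeight c u σ (ccflEpoch c u σ j₀) n i
  -- Facilities opened for missed clients, each of charge at most `Z`; all the others have passed
  -- their threshold and lie in `A`.
  set B := (J.filter fun j => ω ∈ missed c u σ j).biUnion fun j => {ccflTarget c u i₀ ω σ j}
  have hsub : (J.biUnion fun j => {ccflTarget c u i₀ ω σ j}) ⊆ A ∪ B := by
    intro i hi
    obtain ⟨j, hj, hij⟩ := Finset.mem_biUnion.1 hi
    rw [Finset.mem_singleton] at hij
    subst hij
    by_cases hω : ω ∈ missed c u σ j
    · exact Finset.mem_union_right _ (Finset.mem_biUnion.2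
        ⟨j, Finset.mem_filter.2 ⟨hj, hω⟩, Finset.mem_singleton_self _⟩)
    · refine Finset.mem_union_left _ (Finset.mem_filter.2 ⟨Finset.mem_univ _, ?_, ?_⟩)
      · rw [← ccflZ_eq_of_mem hj]
        exact (H.parts_le_of_affordable (H.ccflTarget_mem_affordable hm i₀ ω j)).1
      · have h1 := (Finset.mem_filter.1 (ccflTarget_mem_ready i₀ (ready_nonempty hω))).2
        rw [(Finset.mem_filter.1 hj).2] at h1
        exact h1.trans (mul_le_mul_of_nonneg_left (R.mono j.2 le_rfl _) hn)
  have hA : ∑ i ∈ A, c i ≤ openingBound c u σ j₀ ω := by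
    rw [openingBound, Finset.sum_filter]
    refine Finset.sum_le_sum fun i _ => ?_
    split_ifs with h
    · rw [Set.indicator_of_mem (by exact h.2)]
      exact le_mul_normalizedCharge hZ h.1
    · exact Set.indicator_nonneg (fun _ _ => mul_nonneg hZ.le (normalizedCharge_pos hm _ _).le) _
  have hB : ∑ i ∈ B, c i ≤ missedCost c u σ j₀ ω := by
    refine (sum_biUnion_le_of_nonneg _ _ _ H.charge_nonneg).trans ?_
    rw [missedCost, Finset.sum_filter]
    refine Finset.sum_le_sum fun j hj => ?_
    rw [Finset.sum_singleton, Set.indicator_apply]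
    split_ifs with h
    · rw [← ccflZ_eq_of_mem hj]
      exact (H.parts_le_of_affordable (H.ccflTarget_mem_affordable hm i₀ ω j)).1
    · exact le_rfl
  have h1 := Finset.sum_le_sum_of_subset_of_nonneg hsub fun i _ _ => H.charge_nonneg i
  have h2 := Finset.sum_union_inter (s₁ := A) (s₂ := B) (f := c)
  linarith [H.sum_charge_nonneg (A ∩ B)]

lemma sum_assign_le (H : ValidInput c u σ) (hm : 0 < m) (i₀ : Fin m) (j₀ : Fin n)
    (ω : Fin m → ℝ) :
    ∑ j ∈ epochMates c u σ j₀, (σ j).assignCost (ccflTarget c u i₀ ω σ j)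
      ≤ assignBound c u σ j₀ ω + missedCost c u σ j₀ ω := by
  have hZ := H.ccflZ_pos hm j₀
  rw [assignBound, missedCost, ← Finset.sum_add_distrib]
  refine Finset.sum_le_sum fun j hj => ?_
  have h0 : ∀ i, 0 ≤ {ω : Fin m → ℝ | ω i ≤
      Real.log (m * n) * ccflWeight c u σ (ccflEpoch c u σ j) (j + 1) i}.indicator
      (fun _ => (σ j).assignCost i) ω :=
    fun i => Set.indicator_nonneg (fun _ _ => H.assign_nonneg j i) _
  by_cases hω : ω ∈ missed c u σ j
  · rw [Set.indicator_of_mem hω]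
    have h1 := (H.parts_le_of_affordable (H.ccflTarget_mem_affordable hm i₀ ω j)).2.2
    rw [ccflZ_eq_of_mem hj] at h1
    linarith [Finset.sum_nonneg fun i (_ : i ∈ offered c u σ j) => h0 i]
  · rw [Set.indicator_of_notMem hω, add_zero]
    obtain ⟨h1, h2⟩ := Finset.mem_filter.1 (ccflTarget_mem_ready i₀ (ready_nonempty hω))
    refine le_trans ?_ (Finset.single_le_sum (fun i _ => h0 i) h1)
    rw [Set.indicator_of_mem (by exact h2)]

lemma integrable_missedCost (j₀ : Fin n) :
    Integrable (missedCost c u σ j₀) (thresholdMeasure m) :=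
  integrable_finsetSum _ fun j _ =>
    (integral_threshold_indicator _ (measurableSet_missed j) _).1

lemma integrable_openingBound (j₀ : Fin n) :
    Integrable (openingBound c u σ j₀) (thresholdMeasure m) :=
  integrable_finsetSum _ fun i _ =>
    (integral_threshold_indicator _ (measurableSet_threshold_le i _) _).1

lemma integrable_assignBound (j₀ : Fin n) :
    Integrable (assignBound c u σ j₀) (thresholdMeasure m) :=
  integrable_finsetSum _ fun _ _ => integrable_finsetSum _ fun i _ =>
    (integral_threshold_indicator _ (measurableSet_threshold_le i _) _).1

/-- Scaling by `log (m n)` brings the probability of a miss down to `1 / (m n) ≤ 1 / n`, and there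
are at most `n` clients. -/
lemma integral_missedCost_le (H : ValidInput c u σ) (hm : 0 < m) (hL : 1 ≤ Real.log (m * n))
    (j₀ : Fin n) : ∫ ω, missedCost c u σ j₀ ω ∂thresholdMeasure m ≤ ccflZ c u σ j₀ := by
  have hZ := H.ccflZ_pos hm j₀
  have hn : 0 < n := j₀.pos
  obtain ⟨τ, f, R⟩ := H.exists_isRun hm j₀
  unfold missedCost
  rw [integral_finsetSum _ fun j _ =>
    (integral_threshold_indicator _ (measurableSet_missed j) _).1]
  have hmn : Real.exp (-Real.log (m * n)) ≤ 1 / n := by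
    rw [Real.exp_neg, Real.exp_log (by positivity), ← one_div]
    have : (1 : ℝ) ≤ m := by exact_mod_cast hm
    exact one_div_le_one_div_of_le (by positivity) (le_mul_of_one_le_left (by positivity) this)
  calc ∑ j ∈ epochMates c u σ j₀, ∫ ω, (missed c u σ j).indicator
          (fun _ => ccflZ c u σ j₀) ω ∂thresholdMeasure m
      ≤ ∑ j ∈ epochMates c u σ j₀, 1 / n * ccflZ c u σ j₀ := by
        refine Finset.sum_le_sum fun j hj => ?_
        rw [(integral_threshold_indicator _ (measurableSet_missed j) _).2]
        refine mul_le_mul_of_nonneg_right (le_trans ?_ hmn) hZ.le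
        refine thresholdMeasure_forall_lt_le hL _ _ ?_
        rw [(Finset.mem_filter.1 hj).2]
        exact (R.step j hj).cover
    _ ≤ ∑ _j : Fin n, 1 / n * ccflZ c u σ j₀ :=
        Finset.sum_le_sum_of_subset_of_nonneg (Finset.subset_univ _) fun _ _ _ => by positivity
    _ = ccflZ c u σ j₀ := by
        rw [Finset.sum_const, Finset.card_univ, Fintype.card_fin, nsmul_eq_mul]
        field_simp

lemma integral_openingBound_le (H : ValidInput c u σ) (hm : 0 < m) (hL : 1 ≤ Real.log (m * n))
    (j₀ : Fin n) : ∫ ω, openingBound c u σ j₀ ω ∂thresholdMeasure m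
      ≤ ccflZ c u σ j₀ * (Real.log (m * n) * (16 + 20 * Real.log m)) := by
  have hZ := H.ccflZ_pos hm j₀
  obtain ⟨τ, f, R⟩ := H.exists_isRun hm j₀
  unfold openingBound
  rw [integral_finsetSum _ fun i _ =>
    (integral_threshold_indicator _ (measurableSet_threshold_le i _) _).1]
  calc _ ≤ ∑ i, ccflZ c u σ j₀ * (Real.log (m * n) * (normalizedCharge c (ccflZ c u σ j₀) i
          * ccflWeight c u σ (ccflEpoch c u σ j₀) n i)) := by
        refine Finset.sum_le_sum fun i _ => ?_
        rw [(integral_threshold_indicator _ (measurableSet_threshold_le i _) _).2]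
        have h1 := thresholdMeasure_le i (mul_nonneg (zero_le_one.trans hL)
          (H.ccflWeight_pos hm (ccflEpoch c u σ j₀) n i).le)
        have h2 := mul_le_mul_of_nonneg_right h1
          (mul_nonneg hZ.le (normalizedCharge_pos (c := c) hm (ccflZ c u σ j₀) i).le)
        linarith
    _ = ccflZ c u σ j₀ * (Real.log (m * n) * ∑ i, normalizedCharge c (ccflZ c u σ j₀) i
          * ccflWeight c u σ (ccflEpoch c u σ j₀) n i) := by
        rw [Finset.mul_sum, Finset.mul_sum]
    _ ≤ _ := by
        have := R.sum_charge_le_log hm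
        gcongr

lemma integral_assignBound_le (H : ValidInput c u σ) (hm : 0 < m) (hL : 1 ≤ Real.log (m * n))
    (j₀ : Fin n) : ∫ ω, assignBound c u σ j₀ ω ∂thresholdMeasure m
      ≤ ccflZ c u σ j₀ * (Real.log (m * n) * (12 + 16 * Real.log m)) := by
  have hZ := H.ccflZ_pos hm j₀
  obtain ⟨τ, f, R⟩ := H.exists_isRun hm j₀
  unfold assignBound
  rw [integral_finsetSum _ fun _ _ => integrable_finsetSum _ fun i _ =>
    (integral_threshold_indicator _ (measurableSet_threshold_le i _) _).1]
  calc _ ≤ ∑ j ∈ epochMates c u σ j₀, ccflZ c u σ j₀ * (Real.log (m * n) * (4 * τ j)) := by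
        refine Finset.sum_le_sum fun j hj => ?_
        have hs := (R.step j hj).assign
        rw [← (Finset.mem_filter.1 hj).2] at hs
        rw [integral_finsetSum _ fun i _ =>
          (integral_threshold_indicator _ (measurableSet_threshold_le i _) _).1]
        calc _ ≤ ∑ i ∈ offered c u σ j, ccflZ c u σ j₀ * (Real.log (m * n) *
                ((σ j).assignCost i / ccflZ c u σ j₀
                  * min 1 (ccflWeight c u σ (ccflEpoch c u σ j) (j + 1) i))) := by
              refine Finset.sum_le_sum fun i _ => ?_
              rw [(integral_threshold_indicator _ (measurableSet_threshold_le i _) _).2]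
              set y := ccflWeight c u σ (ccflEpoch c u σ j) (j + 1) i
              have hy : 0 < y := H.ccflWeight_pos hm _ _ i
              -- Truncation at one commutes with the scaling up to the factor `L ≥ 1`, which matches
              -- the truncated weights in `IsStep.assign`.
              have h1 : (thresholdMeasure m).real {ω | ω i ≤ Real.log (m * n) * y}
                  ≤ Real.log (m * n) * min 1 y :=
                (le_min measureReal_le_one ((thresholdMeasure_le i (by positivity)).trans_eq
                  (mul_comm _ _))).trans (min_one_mul_le hL)
              refine (mul_le_mul_of_nonneg_right h1 (H.assign_nonneg j i)).trans_eq ?_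
              field_simp
          _ = ccflZ c u σ j₀ * (Real.log (m * n) * ∑ i ∈ offered c u σ j,
                (σ j).assignCost i / ccflZ c u σ j₀
                  * min 1 (ccflWeight c u σ (ccflEpoch c u σ j) (j + 1) i)) := by
              rw [Finset.mul_sum, Finset.mul_sum]
          _ ≤ _ := by gcongr
    _ = ccflZ c u σ j₀ * (Real.log (m * n) * (4 * ∑ j ∈ epochMates c u σ j₀, τ j)) := by
        rw [Finset.mul_sum, Finset.mul_sum, Finset.mul_sum]
    _ ≤ _ := by
        have : 4 * ∑ j ∈ epochMates c u σ j₀, τ j ≤ 12 + 16 * Real.log m := by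
          linarith [show ∑ j ∈ epochMates c u σ j₀, τ j ≤ _ from R.sum_price_le hm]
        gcongr

/-- The cost of an epoch is dominated by a random variable of expectation `O(log² (m n)) Z`. -/
theorem exists_epoch_bound (H : ValidInput c u σ) (hm : 2 ≤ m) (hn : 2 ≤ n) (i₀ : Fin m)
    (j₀ : Fin n) : ∃ B : (Fin m → ℝ) → ℝ, Integrable B (thresholdMeasure m) ∧
      (∀ ω, ccflCost c u σ (epochMates c u σ j₀)
        ((epochMates c u σ j₀).biUnion fun j => {ccflTarget c u i₀ ω σ j})
        (ccflTarget c u i₀ ω σ) ≤ B ω) ∧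
      ∫ ω, B ω ∂thresholdMeasure m ≤ 447 * Real.log (m * n) ^ 2 * ccflZ c u σ j₀ := by
  have hm0 : 0 < m := by omega
  have hL := one_le_log_mul hm hn
  have hZ := H.ccflZ_pos hm0 j₀
  have i1 := (integrable_missedCost (c := c) (u := u) (σ := σ) j₀).const_mul 3
  have i2 := integrable_openingBound (c := c) (u := u) (σ := σ) j₀
  have i3 := integrable_assignBound (c := c) (u := u) (σ := σ) j₀
  have i0 := integrable_const (μ := thresholdMeasure m)
    (ccflZ c u σ j₀ * (160 + 220 * Real.log m))
  refine ⟨fun ω => ccflZ c u σ j₀ * (160 + 220 * Real.log m) + 3 * missedCost c u σ j₀ ω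
    + openingBound c u σ j₀ ω + assignBound c u σ j₀ ω, ((i0.add i1).add i2).add i3, ?_, ?_⟩
  · intro ω
    unfold ccflCost
    linarith [H.iSup_congestion_le hm0 i₀ j₀ ω, H.sum_opening_le hm0 (zero_le_one.trans hL) i₀ j₀ ω,
      H.sum_assign_le hm0 i₀ j₀ ω]
  · have e1 : ∫ ω, (ccflZ c u σ j₀ * (160 + 220 * Real.log m) + 3 * missedCost c u σ j₀ ω
        + openingBound c u σ j₀ ω + assignBound c u σ j₀ ω) ∂thresholdMeasure m
        = ccflZ c u σ j₀ * (160 + 220 * Real.log m)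
          + 3 * ∫ ω, missedCost c u σ j₀ ω ∂thresholdMeasure m
          + ∫ ω, openingBound c u σ j₀ ω ∂thresholdMeasure m
          + ∫ ω, assignBound c u σ j₀ ω ∂thresholdMeasure m := by
      rw [integral_add (by exact (i0.add i1).add i2) i3, integral_add (by exact i0.add i1) i2,
        integral_add i0 i1, integral_const, probReal_univ, one_smul, integral_const_mul]
    rw [e1]
    have b1 := H.integral_missedCost_le hm0 hL j₀
    have b2 := H.integral_openingBound_le hm0 hL j₀
    have b3 := H.integral_assignBound_le hm0 hL j₀
    set L := Real.log (m * n) with hLdef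
    have hlm : Real.log m ≤ L := by
      have h1 : (1 : ℝ) ≤ n := by exact_mod_cast (by omega : 1 ≤ n)
      exact Real.log_le_log (by positivity) (le_mul_of_one_le_right (by positivity) h1)
    have hL2 : L ≤ L ^ 2 := by nlinarith
    -- Here `log m ≤ L` and `1 ≤ L`, and the coefficients add up to 447. The 3 counts a miss once
    -- each in congestion, charges and assignment.
    have h4 : 160 + 220 * Real.log m + 3 + L * (16 + 20 * Real.log m)
        + L * (12 + 16 * Real.log m) ≤ 447 * L ^ 2 := by
      have := mul_le_mul_of_nonneg_left hlm (zero_le_one.trans hL)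
      nlinarith
    have h5 := mul_le_mul_of_nonneg_left h4 hZ.le
    linarith

end EpochCost

end ValidInput

/-! ### Summation over the epochs -/

namespace ValidInput

variable {m n : ℕ} {c u : Fin m → ℝ} {σ : Fin n → Client m}

/-- The cost of a run is at most the sum of the costs of its epochs. -/
lemma cost_le_sum_epochs (H : ValidInput c u σ) (hm : 0 < m)
    (A : EpochAlgorithm (Client m) m n) (ω : A.Ω) :
    ccflCost c u σ Finset.univ (A.opened ω σ) (A.target ω σ)
      ≤ ∑ k ∈ A.epochs σ, ccflCost c u σ (A.served σ k) (A.openedIn ω σ k) (A.target ω σ) := by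
  have : Nonempty (Fin m) := ⟨⟨0, hm⟩⟩
  have hmem : ∀ j ∈ (Finset.univ : Finset (Fin n)), A.epoch σ j ∈ A.epochs σ := fun j hj =>
    Finset.mem_image_of_mem _ hj
  unfold ccflCost
  rw [Finset.sum_add_distrib, Finset.sum_add_distrib]
  refine add_le_add (add_le_add ?_ ?_) ?_
  · refine ciSup_le fun i => ?_
    refine le_trans (le_of_eq ?_) (Finset.sum_le_sum fun k _ => le_ciSup (Set.finite_range fun i =>
      (∑ j ∈ A.served σ k with A.target ω σ j = i, (σ j).demand i) / u i).bddAbove i)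
    rw [← Finset.sum_div, Finset.sum_filter, ← Finset.sum_fiberwise_of_maps_to hmem]
    congr 1
    exact Finset.sum_congr rfl fun k _ => (Finset.sum_filter _ _).symm
  · refine le_trans (Finset.sum_le_sum_of_subset_of_nonneg ?_ fun i _ _ => H.charge_nonneg i)
      (sum_biUnion_le_of_nonneg (A.epochs σ) (A.openedIn ω σ) c H.charge_nonneg)
    intro i hi
    obtain ⟨j, hj, hij⟩ := Finset.mem_biUnion.1 hi
    exact Finset.mem_biUnion.2 ⟨A.epoch σ j, hmem j hj, Finset.mem_biUnion.2
      ⟨j, Finset.mem_filter.2 ⟨Finset.mem_univ _, rfl⟩, hij⟩⟩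
  · rw [← Finset.sum_fiberwise_of_maps_to hmem]
    rfl

lemma one_le_costRatio (H : ValidInput c u σ) (hm : 0 < m) (hn : 0 < n) :
    1 ≤ costRatio (ccflSingle c u σ) := by
  have : Nonempty (Fin m) := ⟨⟨0, hm⟩⟩
  let j₀ : Fin n := ⟨0, hn⟩
  refine le_trans ?_ (le_ciSup (Set.finite_range _).bddAbove j₀)
  obtain ⟨i, hi⟩ := exists_eq_ciInf_of_finite (f := ccflSingle c u σ j₀)
  rw [← hi, one_le_div (H.single_pos j₀ i)]
  exact le_ciSup (Set.finite_range _).bddAbove i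

lemma one_le_log_mul_costRatio (H : ValidInput c u σ) (hm : 2 ≤ m) (hn : 2 ≤ n) :
    1 ≤ Real.log (m * n * costRatio (ccflSingle c u σ)) := by
  refine (one_le_log_mul hm hn).trans (Real.log_le_log (by positivity) ?_)
  exact le_mul_of_one_le_right (by positivity) (H.one_le_costRatio (by omega) (by omega))

/-- Since `Z` doubles, the parameters of the epochs add up to a multiple of the optimum. -/
lemma sum_epoch_Z_le (H : ValidInput c u σ) (hm : 0 < m) (hn : 0 < n) (i₀ : Fin m) :
    ∑ k ∈ (ccflAlgorithm c u i₀).epochs σ, 2 ^ k * initialZ c u σ ⟨0, hn⟩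
      ≤ 4 * ccflOpt c u σ := by
  have hz := H.initialZ_pos hm (⟨0, hn⟩ : Fin n)
  let l : Fin n := ⟨n - 1, by omega⟩
  have hsub : (ccflAlgorithm c u i₀).epochs σ ⊆ Finset.range (ccflEpoch c u σ l + 1) := by
    intro k hk
    obtain ⟨j, -, rfl⟩ := Finset.mem_image.1 hk
    refine Finset.mem_range.2 (Nat.lt_succ_of_le ((ccflAlgorithm c u i₀).epoch_monotone σ ?_))
    exact Fin.le_def.2 (Nat.le_sub_one_of_lt j.2)
  have h1 : ∑ k ∈ Finset.range (ccflEpoch c u σ l + 1), (2 : ℝ) ^ k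
      ≤ 2 * 2 ^ ccflEpoch c u σ l := by
    rw [geom_sum_eq (by norm_num), pow_succ]
    linarith
  have h2 : 2 ^ ccflEpoch c u σ l * initialZ c u σ ⟨0, hn⟩ ≤ 2 * ccflOpt c u σ :=
    H.ccflZ_le_two_mul_opt hm l
  calc ∑ k ∈ (ccflAlgorithm c u i₀).epochs σ, 2 ^ k * initialZ c u σ ⟨0, hn⟩
      ≤ ∑ k ∈ Finset.range (ccflEpoch c u σ l + 1), 2 ^ k * initialZ c u σ ⟨0, hn⟩ :=
        Finset.sum_le_sum_of_subset_of_nonneg hsub fun _ _ _ => by positivity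
    _ = (∑ k ∈ Finset.range (ccflEpoch c u σ l + 1), 2 ^ k) * initialZ c u σ ⟨0, hn⟩ :=
        (Finset.sum_mul _ _ _).symm
    _ ≤ 2 * 2 ^ ccflEpoch c u σ l * initialZ c u σ ⟨0, hn⟩ := by gcongr
    _ ≤ 4 * ccflOpt c u σ := by linarith

theorem ccflAlgorithm_cost_le (H : ValidInput c u σ) (hm : 2 ≤ m) (hn : 2 ≤ n) (i₀ : Fin m) :
    ccflEpochCost c u σ (ccflAlgorithm c u i₀) ≤ 1788 * Real.log (m * n) ^ 2 * ccflOpt c u σ ∧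
    ccflTotalCost c u σ (ccflAlgorithm c u i₀)
      ≤ 1788 * Real.log (m * n) ^ 2 * ccflOpt c u σ := by
  have hn0 : 0 < n := by omega
  have hm0 : 0 < m := by omega
  -- Stated for all `k`, with the zero function as a dummy outside the epochs, so that `choose`
  -- yields a family that does not depend on membership proofs.
  have hex : ∀ k : ℕ, ∃ B : (Fin m → ℝ) → ℝ, k ∈ (ccflAlgorithm c u i₀).epochs σ →
      Integrable B (thresholdMeasure m) ∧
      (∀ ω, ccflCost c u σ ((ccflAlgorithm c u i₀).served σ k)
        ((ccflAlgorithm c u i₀).openedIn ω σ k) (ccflTarget c u i₀ ω σ) ≤ B ω) ∧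
      ∫ ω, B ω ∂thresholdMeasure m
        ≤ 447 * Real.log (m * n) ^ 2 * (2 ^ k * initialZ c u σ ⟨0, hn0⟩) := by
    intro k
    by_cases hk : k ∈ (ccflAlgorithm c u i₀).epochs σ
    · obtain ⟨j, -, rfl⟩ := Finset.mem_image.1 hk
      obtain ⟨B, hB⟩ := H.exists_epoch_bound hm hn i₀ j
      exact ⟨B, fun _ => hB⟩
    · exact ⟨0, fun h => absurd h hk⟩
  choose B hB using hex
  have hsum : ∑ k ∈ (ccflAlgorithm c u i₀).epochs σ, ∫ ω, B k ω ∂thresholdMeasure m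
      ≤ 1788 * Real.log (m * n) ^ 2 * ccflOpt c u σ := by
    refine (Finset.sum_le_sum fun k hk => (hB k hk).2.2).trans ?_
    rw [← Finset.mul_sum]
    have := mul_le_mul_of_nonneg_left (H.sum_epoch_Z_le hm0 hn0 i₀)
      (by positivity : 0 ≤ 447 * Real.log (m * n) ^ 2)
    linarith
  constructor
  · refine le_trans (Finset.sum_le_sum fun k hk => ?_) hsum
    -- Only the dominating variable must be integrable; the cost itself needs only to be
    -- nonnegative.
    exact integral_mono_of_nonneg (Filter.Eventually.of_forall fun ω => H.cost_nonneg _ _ _)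
      (hB k hk).1 (Filter.Eventually.of_forall (hB k hk).2.1)
  · refine le_trans ?_ hsum
    rw [← integral_finsetSum _ fun k hk => (hB k hk).1]
    refine integral_mono_of_nonneg (Filter.Eventually.of_forall fun ω => H.cost_nonneg _ _ _)
      (integrable_finsetSum _ fun k hk => (hB k hk).1) (Filter.Eventually.of_forall fun ω => ?_)
    exact (H.cost_le_sum_epochs hm0 (ccflAlgorithm c u i₀) ω).trans
      (Finset.sum_le_sum fun k hk => (hB k hk).2.1 ω)

lemma ccflOpt_nonneg (H : ValidInput c u σ) : 0 ≤ ccflOpt c u σ :=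
  Real.iInf_nonneg fun _ => H.cost_nonneg _ _ _

/-- The guarantees of the algorithm for capacity-constrained facility location. -/
theorem ccflAlgorithm_spec (H : ValidInput c u σ) (hm : 2 ≤ m) (hn : 2 ≤ n) (i₀ : Fin m) :
    (∀ ω j, ccflSingle c u σ j ((ccflAlgorithm c u i₀).target ω σ j)
      ≤ (ccflAlgorithm c u i₀).currentZ (ccflSingle c u σ) σ j) ∧
    (∀ j, (ccflAlgorithm c u i₀).currentZ (ccflSingle c u σ) σ j ≤ 2 * ccflOpt c u σ) ∧
    ccflEpochCost c u σ (ccflAlgorithm c u i₀) ≤ 1788 * (Real.log (m * n) ^ 2 *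
      Real.log (m * n * costRatio (ccflSingle c u σ))) * ccflOpt c u σ ∧
    ccflTotalCost c u σ (ccflAlgorithm c u i₀) ≤ 1788 * (Real.log (m * n) ^ 2 *
      Real.log (m * n * costRatio (ccflSingle c u σ))) * ccflOpt c u σ := by
  have hm0 : 0 < m := by omega
  have hle : 1788 * Real.log (m * n) ^ 2 * ccflOpt c u σ ≤ 1788 * (Real.log (m * n) ^ 2 *
      Real.log (m * n * costRatio (ccflSingle c u σ))) * ccflOpt c u σ := by
    refine mul_le_mul_of_nonneg_right ?_ H.ccflOpt_nonneg
    refine mul_le_mul_of_nonneg_left ?_ (by norm_num)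
    exact le_mul_of_one_le_right (by positivity) (H.one_le_log_mul_costRatio hm hn)
  obtain ⟨h1, h2⟩ := H.ccflAlgorithm_cost_le hm hn i₀
  exact ⟨fun ω j => mem_affordable.1 (H.ccflTarget_mem_affordable hm0 i₀ ω j),
    fun j => H.ccflZ_le_two_mul_opt hm0 j, h1.trans hle, h2.trans hle⟩

end ValidInput

/-! ### Scheduling as a special case, and the theorem -/

/-- An algorithm for requests of type `R` serves requests of type `S` that translate into `R`. -/
def EpochAlgorithm.comap {R S : Type} {m n : ℕ} (A : EpochAlgorithm R m n) (g : S → R) :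
    EpochAlgorithm S m n where
  Ω := A.Ω
  μ := A.μ
  epoch σ := A.epoch (g ∘ σ)
  newOpen ω σ := A.newOpen ω (g ∘ σ)
  target ω σ := A.target ω (g ∘ σ)
  epoch_online _ _ _ h := A.epoch_online _ _ _ fun k hk => congrArg g (h k hk)
  newOpen_online _ _ _ _ h := A.newOpen_online _ _ _ _ fun k hk => congrArg g (h k hk)
  target_online _ _ _ _ h := A.target_online _ _ _ _ fun k hk => congrArg g (h k hk)
  epoch_monotone _ := A.epoch_monotone _
  target_open _ _ := A.target_open _ _
  measurableSet_newOpen _ := A.measurableSet_newOpen _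
  measurableSet_target _ := A.measurableSet_target _

/-- A job as a client without assignment costs. -/
def jobClient {m : ℕ} (p : Fin m → ℝ) : Client m where
  assignCost _ := 0
  demand := p

section Jobs

variable {m n : ℕ} (c : Fin m → ℝ) (p : Fin n → Fin m → ℝ)

lemma umscSingle_eq : umscSingle c p = ccflSingle c (fun _ => 1) (jobClient ∘ p) := by
  funext j i
  simp [umscSingle, ccflSingle, jobClient]

lemma umscCost_eq (J : Finset (Fin n)) (O : Finset (Fin m)) (f : Fin n → Fin m) :
    umscCost c p J O f = ccflCost c (fun _ => 1) (jobClient ∘ p) J O f := by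
  simp [umscCost, ccflCost, jobClient]

lemma umscOpt_eq : umscOpt c p = ccflOpt c (fun _ => 1) (jobClient ∘ p) := by
  simp only [umscOpt, ccflOpt, umscCost_eq]

lemma umscEpochCost_comap (A : EpochAlgorithm (Client m) m n) :
    umscEpochCost c p (A.comap jobClient)
      = ccflEpochCost c (fun _ => 1) (jobClient ∘ p) A := by
  simp only [umscEpochCost, ccflEpochCost, umscCost_eq]
  rfl

lemma umscTotalCost_comap (A : EpochAlgorithm (Client m) m n) :
    umscTotalCost c p (A.comap jobClient)
      = ccflTotalCost c (fun _ => 1) (jobClient ∘ p) A := by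
  simp only [umscTotalCost, ccflTotalCost, umscCost_eq]
  rfl

end Jobs

theorem theorem8 :
    ∃ C : ℝ, 0 < C ∧ ∀ m n : ℕ, 2 ≤ m → 2 ≤ n →
      -- capacity-constrained facility location
      (∀ c u : Fin m → ℝ, (∀ i, 0 ≤ c i) → (∀ i, 0 < u i) →
        ∃ A : EpochAlgorithm (Client m) m n, ∀ σ : Fin n → Client m,
          (∀ j i, 0 ≤ (σ j).demand i) → (∀ j i, 0 ≤ (σ j).assignCost i) →
          (∀ j i, 0 < ccflSingle c u σ j i) →
          (∀ ω j, ccflSingle c u σ j (A.target ω σ j) ≤ A.currentZ (ccflSingle c u σ) σ j) ∧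
          (∀ j, A.currentZ (ccflSingle c u σ) σ j ≤ 2 * ccflOpt c u σ) ∧
          ccflEpochCost c u σ A ≤ C * (Real.log (m * n) ^ 2 *
            Real.log (m * n * costRatio (ccflSingle c u σ))) * ccflOpt c u σ ∧
          ccflTotalCost c u σ A ≤ C * (Real.log (m * n) ^ 2 *
            Real.log (m * n * costRatio (ccflSingle c u σ))) * ccflOpt c u σ) ∧
      -- unrelated machine scheduling with start-up costs
      (∀ c : Fin m → ℝ, (∀ i, 0 ≤ c i) →
        ∃ A : EpochAlgorithm (Fin m → ℝ) m n, ∀ p : Fin n → Fin m → ℝ,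
          (∀ j i, 0 ≤ p j i) → (∀ j i, 0 < umscSingle c p j i) →
          (∀ ω j, umscSingle c p j (A.target ω p j) ≤ A.currentZ (umscSingle c p) p j) ∧
          (∀ j, A.currentZ (umscSingle c p) p j ≤ 2 * umscOpt c p) ∧
          umscEpochCost c p A ≤ C * (Real.log (m * n) ^ 2 *
            Real.log (m * n * costRatio (umscSingle c p))) * umscOpt c p ∧
          umscTotalCost c p A ≤ C * (Real.log (m * n) ^ 2 *
            Real.log (m * n * costRatio (umscSingle c p))) * umscOpt c p) := by
  -- `1788 = 4 * 447`: the bound for one epoch times the factor from summing the doubling values of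
  -- `Z`.
  refine ⟨1788, by norm_num, fun m n hm hn => ⟨fun c u hc hu => ?_, fun c hc => ?_⟩⟩
  · exact ⟨ccflAlgorithm c u ⟨0, by omega⟩, fun σ hd ha hw =>
      ValidInput.ccflAlgorithm_spec ⟨hc, hu, hd, ha, hw⟩ hm hn _⟩
  · refine ⟨(ccflAlgorithm c (fun _ => 1) ⟨0, by omega⟩).comap jobClient, fun p hp hw => ?_⟩
    have H : ValidInput c (fun _ => 1) (jobClient ∘ p) :=
      ⟨hc, fun _ => one_pos, hp, fun _ _ => le_rfl, umscSingle_eq c p ▸ hw⟩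
    rw [umscEpochCost_comap, umscTotalCost_comap, umscOpt_eq, umscSingle_eq]
    exact H.ccflAlgorithm_spec hm hn _
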